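/- **Setting.** A *plane tree* is a set $t$ of finite words over $\mathbb N=\{1,2,\dots\}$ that contains the empty word $\varnothing$ (the root), contains the parent $(u_1,\dots,u_{n-1})$ of each of its non-empty words $(u_1,\dots,u_n)$, and is such that for every $u\in t$ there is a finite integer $c_u(t)\ge 0$ (the number of children of $u$) with $ui\in t$ if and only if $1\le i\le c_u(t)$. Two plane trees are equivalent, $t\sim t'$, if there is a bijection $t\to t'$ preserving the root and the parent relation; let $\mathbb T$ be the set of equivalence classes, called (unordered, rooted, locally finite, possibly infinite) trees. A leaf is a vertex without children. Let $\tau|_R$ be the closed ball of radius $R$ around the root of $\tau$ for the graph distance, viewed as a tree, and equip $\mathbb T$ with the local distance $$d_{\mathrm{loc}}(\tau,\sigma)=\exp\bigl[-\inf\{R\ge 0:\ \tau|_R\neq\sigma|_R\}\bigr]$$ and its Borel $\sigma$-algebra. Let $\xi$ be a probability measure on $\mathbb Z_+$ with mean $1$ and $\xi(1)<1$. The Galton–Watson law $\mathrm{GW}_\xi$ is the measure on $\mathbb T$ carried by the finite trees with $$\mathrm{GW}_\xi(\tau)=\sum_{t\in\tau}\ \prod_{u\in t}\xi\bigl(c_u(t)\bigr)$$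 for every finite tree $\tau$, the sum being over the plane trees $t$ in the class $\tau$. For $n\ge1$, let $\mathbb T_n$ and $\mathbb T_{\mathcal L,n}$ be the sets of finite trees with $n$ vertices and with $n$ leaves respectively; when $\mathrm{GW}_\xi(\mathbb T_n)>0$ let $\mathrm{GW}_\xi^n$ be $\mathrm{GW}_\xi$ conditioned on $\mathbb T_n$, and when $\mathrm{GW}_\xi(\mathbb T_{\mathcal L,n})>0$ let $\mathrm{GW}_\xi^{\mathcal L,n}$ be $\mathrm{GW}_\xi$ conditioned on $\mathbb T_{\mathcal L,n}$. Kesten's law $\mathrm{GW}_\xi^\infty$ is the law of the following random tree. Let $X_n$ ($n\ge0$) and $T_{n,k}$ ($n\ge0$, $k\ge1$) be independent random variables such that $\mathbb P(X_n+1=k)=k\,\xi(k)$ for all $k\geq 0$ and $T_{n,k}$ has law $\mathrm{GW}_\xi$. For every $n$ let $T_n$ be the tree obtained by attaching the roots of $T_{n,1},\dots,T_{n,X_n}$ to a new common root. Finally take an infinite branch with vertices $v_0$ (the root), $v_1,v_2,\dots$, where $v_n$ is the parent of $v_{n+1}$, and for every $n\ge0$ glue the root of $T_n$ on $v_n$.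 **Proposition.** The measures $\mathrm{GW}_\xi^n$ (for $n\ge 1$ with $\mathrm{GW}_\xi(\mathbb T_n)>0$), $\mathrm{GW}_\xi^{\mathcal L,n}$ (for $n\ge 1$ with $\mathrm{GW}_\xi(\mathbb T_{\mathcal L,n})>0$) and $\mathrm{GW}_\xi^\infty$ are probability measures on $\mathbb T$, and, with respect to the topology of $d_{\mathrm{loc}}$, both $$\mathrm{GW}_\xi^n\ \Longrightarrow\ \mathrm{GW}_\xi^\infty\qquad\text{and}\qquad \mathrm{GW}_\xi^{\mathcal L,n}\ \Longrightarrow\ \mathrm{GW}_\xi^\infty$$ weakly as $n\to\infty$ along the integers $n$ for which the respective left-hand side is defined. -/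

import Mathlib

open MeasureTheory Filter Topology
open scoped ENNReal

noncomputable section

/-- A plane tree in Neveu's formalism: a set of finite words, containing the empty word (the root),
stable under taking the parent, in which every vertex `u` has finitely many children
`u0, u1, …, u(c-1)`. (Words are over `ℕ = {0, 1, …}`; the tree may be infinite.) -/
@[ext] structure PlaneTree where
  verts : Set (List ℕ)
  root_mem : [] ∈ verts
  parent_mem : ∀ u : List ℕ, ∀ i : ℕ, u ++ [i] ∈ verts → u ∈ verts
  children : ∀ u ∈ verts, ∃ c : ℕ, ∀ i : ℕ, u ++ [i] ∈ verts ↔ i < c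

namespace PlaneTree

/-- The number `c_u(t)` of children of the vertex `u` in `t`. -/
def numChildren (t : PlaneTree) (u : List ℕ) : ℕ := {i : ℕ | u ++ [i] ∈ t.verts}.ncard

/-- The set of leaves of `t`. -/
def leaves (t : PlaneTree) : Set (List ℕ) := {u | u ∈ t.verts ∧ t.numChildren u = 0}

theorem mem_child_iff (t : PlaneTree) {u : List ℕ} (hu : u ∈ t.verts) (i : ℕ) :
    u ++ [i] ∈ t.verts ↔ i < t.numChildren u := by
  obtain ⟨c, hc⟩ := t.children u hu
  have h : {i : ℕ | u ++ [i] ∈ t.verts} = Set.Iio c := by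
    ext j; simp [hc]
  have h2 : t.numChildren u = c := by
    rw [numChildren, h, ← Finset.coe_Iio, Set.ncard_coe_finset, Nat.card_Iio]
  rw [h2, hc]

theorem prefix_mem (t : PlaneTree) {u v : List ℕ} (h : u ++ v ∈ t.verts) : u ∈ t.verts := by
  induction v using List.reverseRecOn with
  | nil => simpa using h
  | append_singleton v i ih =>
    exact ih (t.parent_mem _ i (by simpa using h))

theorem dropLast_mem (t : PlaneTree) {u : List ℕ} (h : u ∈ t.verts) : u.dropLast ∈ t.verts := by
  induction u using List.reverseRecOn with
  | nil => simpa using h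
  | append_singleton v i ih => simpa using t.parent_mem v i h

/-- The root of `t`, as a vertex. -/
def root (t : PlaneTree) : t.verts := ⟨[], t.root_mem⟩

/-- The parent `(u_1, …, u_{n-1})` of a vertex `(u_1, …, u_n)` (only meant for non-root vertices). -/
def parent (t : PlaneTree) (u : t.verts) : t.verts := ⟨u.1.dropLast, t.dropLast_mem u.2⟩

/-- `t ∼ t'`: there is a bijection between the vertices which preserves the root and the
parent relation. -/
def Equivalent (t t' : PlaneTree) : Prop :=
  ∃ σ : t.verts ≃ t'.verts, σ t.root = t'.root ∧
    ∀ u : t.verts, u ≠ t.root → t'.parent (σ u) = σ (t.parent u)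

theorem Equivalent.refl (t : PlaneTree) : t.Equivalent t :=
  ⟨Equiv.refl _, rfl, fun _ _ => rfl⟩

theorem Equivalent.symm {t t' : PlaneTree} (h : t.Equivalent t') : t'.Equivalent t := by
  obtain ⟨σ, h0, h1⟩ := h
  have h0' : σ.symm t'.root = t.root := by rw [← h0, Equiv.symm_apply_apply]
  refine ⟨σ.symm, h0', fun u hu => ?_⟩
  have hne : σ.symm u ≠ t.root := fun hc => hu (by rw [← h0, ← hc, Equiv.apply_symm_apply])
  rw [Equiv.eq_symm_apply, ← h1 _ hne, Equiv.apply_symm_apply]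

theorem Equivalent.trans {t t' t'' : PlaneTree} (h : t.Equivalent t') (h' : t'.Equivalent t'') :
    t.Equivalent t'' := by
  obtain ⟨σ, h0, h1⟩ := h
  obtain ⟨τ, k0, k1⟩ := h'
  refine ⟨σ.trans τ, by simp [h0, k0], fun u hu => ?_⟩
  have hne : σ u ≠ t'.root := fun hc => hu (σ.injective (by rw [hc, h0]))
  simp only [Equiv.trans_apply]
  rw [k1 _ hne, h1 _ hu]

instance setoid : Setoid PlaneTree where
  r := Equivalent
  iseqv := ⟨Equivalent.refl, Equivalent.symm, Equivalent.trans⟩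

/-- The closed ball `t|_R` of radius `R` centred at the root: the graph distance from a vertex to
the root is the length of the corresponding word. -/
def trunc (R : ℕ) (t : PlaneTree) : PlaneTree where
  verts := {u | u ∈ t.verts ∧ u.length ≤ R}
  root_mem := ⟨t.root_mem, by simp⟩
  parent_mem u i h := ⟨t.parent_mem u i h.1, by have := h.2; simp at this; omega⟩
  children u hu := by
    obtain ⟨c, hc⟩ := t.children u hu.1
    by_cases h : u.length + 1 ≤ R
    · exact ⟨c, fun i => by simp [hc, h]⟩
    · exact ⟨0, fun i => by simp [h]⟩

theorem length_eq_of_iso {t t' : PlaneTree} (σ : t.verts ≃ t'.verts) (h0 : σ t.root = t'.root)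
    (h1 : ∀ u : t.verts, u ≠ t.root → t'.parent (σ u) = σ (t.parent u)) (n : ℕ) :
    ∀ u : t.verts, u.1.length = n → (σ u).1.length = n := by
  induction n with
  | zero =>
    intro u hu
    have : u = t.root := Subtype.ext (List.length_eq_zero_iff.1 hu)
    rw [this, h0]; rfl
  | succ n ih =>
    intro u hu
    have hne : u ≠ t.root := by rintro rfl; simp [root] at hu
    have h2 := ih (t.parent u) (by simp [parent, hu])
    rw [← h1 u hne] at h2
    have hne' : σ u ≠ t'.root := fun hc => hne (σ.injective (by rw [hc, h0]))
    have hne'' : (σ u).1.length ≠ 0 := fun hc =>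
      hne' (Subtype.ext (List.length_eq_zero_iff.1 hc))
    simp only [parent, List.length_dropLast] at h2
    omega

theorem Equivalent.trunc {t t' : PlaneTree} (h : t.Equivalent t') (R : ℕ) :
    (t.trunc R).Equivalent (t'.trunc R) := by
  obtain ⟨σ, h0, h1⟩ := h
  have hl : ∀ u : t.verts, (σ u).1.length = u.1.length :=
    fun u => length_eq_of_iso σ h0 h1 _ u rfl
  have hl' : ∀ u : t'.verts, (σ.symm u).1.length = u.1.length := fun u => by
    rw [← hl, Equiv.apply_symm_apply]
  refine ⟨⟨fun u => ⟨(σ ⟨u.1, u.2.1⟩).1, (σ _).2, by rw [hl]; exact u.2.2⟩,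
    fun u => ⟨(σ.symm ⟨u.1, u.2.1⟩).1, (σ.symm _).2, by rw [hl']; exact u.2.2⟩,
    fun u => by simp, fun u => by simp⟩, ?_, fun u hu => ?_⟩
  · have h2 := congrArg Subtype.val h0
    exact Subtype.ext h2
  · have hne : (⟨u.1, u.2.1⟩ : t.verts) ≠ t.root := fun hc => by
      have h2 := congrArg Subtype.val hc
      exact hu (Subtype.ext h2)
    have h2 := congrArg Subtype.val (h1 _ hne)
    exact Subtype.ext h2

/-- The concatenation `⟦t_1, …, t_p⟧`: the roots of the trees are attached to a new common root. -/
def concat {p : ℕ} (ts : Fin p → PlaneTree) : PlaneTree where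
  verts := {w | w = [] ∨ ∃ (i : Fin p) (v : List ℕ), w = (i : ℕ) :: v ∧ v ∈ (ts i).verts}
  root_mem := Or.inl rfl
  parent_mem u i h := by
    rcases u with _ | ⟨a, u⟩
    · exact Or.inl rfl
    · rcases h with h | ⟨j, v, hv, hm⟩
      · simp at h
      · simp only [List.cons_append, List.cons.injEq] at hv
        obtain ⟨rfl, rfl⟩ := hv
        exact Or.inr ⟨j, u, rfl, (ts j).parent_mem u i hm⟩
  children u hu := by
    rcases hu with rfl | ⟨j, v, rfl, hm⟩
    · refine ⟨p, fun i => ⟨?_, fun hi => Or.inr ⟨⟨i, hi⟩, [], rfl, (ts _).root_mem⟩⟩⟩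
      rintro (h | ⟨j, v, hv, -⟩)
      · simp at h
      · simp only [List.nil_append, List.cons.injEq] at hv
        rw [hv.1]; exact j.2
    · obtain ⟨c, hc⟩ := (ts j).children v hm
      refine ⟨c, fun i => ⟨?_, fun hi => Or.inr ⟨j, v ++ [i], rfl, (hc i).2 hi⟩⟩⟩
      rintro (h | ⟨k, w, hw, hm'⟩)
      · simp at h
      · simp only [List.cons_append, List.cons.injEq] at hw
        obtain ⟨h1, rfl⟩ := hw
        obtain rfl : j = k := Fin.ext h1
        exact (hc i).1 hm'

theorem not_child_prefix (t : PlaneTree) {u v : List ℕ} {j : ℕ} (hu : u ∈ t.verts) :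
    u ++ (t.numChildren u + j) :: v ∉ t.verts := by
  intro h
  have h2 : u ++ [t.numChildren u + j] ∈ t.verts := t.prefix_mem (v := v) (by simpa using h)
  rw [t.mem_child_iff hu] at h2
  omega

theorem graft_decomp (t : PlaneTree) {u u' v v' : List ℕ} {j j' : ℕ} (hu : u ∈ t.verts)
    (hu' : u' ∈ t.verts)
    (h : u ++ (t.numChildren u + j) :: v = u' ++ (t.numChildren u' + j') :: v') :
    u = u' ∧ j = j' ∧ v = v' := by
  have key : ∀ {u u' v v' a : List ℕ} {j j' : ℕ}, u ∈ t.verts → u' ∈ t.verts → u' = u ++ a →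
      (t.numChildren u + j) :: v = a ++ (t.numChildren u' + j') :: v' → u = u' := by
    intro u u' v v' a j j' hu hu' ha hv
    rcases a with _ | ⟨x, a⟩
    · simpa using ha.symm
    · simp only [List.cons_append, List.cons.injEq] at hv
      rw [ha, ← hv.1] at hu'
      exact absurd hu' (t.not_child_prefix hu)
  have huu : u = u' := by
    rcases List.append_eq_append_iff.1 h with ⟨a, h1, h2⟩ | ⟨a, h1, h2⟩
    · exact key hu hu' h1 h2
    · exact (key hu' hu h1 h2).symm
  subst huu
  have h3 := List.append_cancel_left h
  simp only [List.cons.injEq] at h3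
  exact ⟨rfl, by omega, h3.2⟩

/-- The grafting `t ⨂_u (u, s_u)`: for every vertex `u` of `t` the root of `s u` is glued on `u`.
The children of the root of `s u` become additional children of `u`, listed after those
that `u` has in `t`. -/
def graft (t : PlaneTree) (s : t.verts → PlaneTree) : PlaneTree where
  verts := {w | w ∈ t.verts ∨ ∃ (u : t.verts) (j : ℕ) (v : List ℕ),
    w = u.1 ++ (t.numChildren u.1 + j) :: v ∧ j :: v ∈ (s u).verts}
  root_mem := Or.inl t.root_mem
  parent_mem w i h := by
    rcases h with h | ⟨u, j, v, hw, hm⟩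
    · exact Or.inl (t.parent_mem w i h)
    · rcases List.eq_nil_or_concat v with rfl | ⟨v, k, rfl⟩
      · have := List.append_inj' hw rfl
        exact Or.inl (this.1 ▸ u.2)
      · have h2 : w ++ [i] = (u.1 ++ (t.numChildren u.1 + j) :: v) ++ [k] := by simpa using hw
        have := List.append_inj' h2 rfl
        exact Or.inr ⟨u, j, v, this.1, (s u).parent_mem (j :: v) k (by simpa using hm)⟩
  children w hw := by
    rcases hw with hw | ⟨u, j, v, rfl, hm⟩
    · refine ⟨t.numChildren w + (s ⟨w, hw⟩).numChildren [], fun i => ⟨?_, fun hi => ?_⟩⟩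
      · rintro (h | ⟨u, j, v, hwu, hm⟩)
        · rw [t.mem_child_iff hw] at h
          omega
        · rcases List.eq_nil_or_concat v with rfl | ⟨v, k, rfl⟩
          · have := List.append_inj' hwu rfl
            obtain rfl : (⟨w, hw⟩ : t.verts) = u := Subtype.ext this.1
            have h3 := this.2
            simp only [List.cons.injEq, and_true] at h3
            have h4 := ((s ⟨w, hw⟩).mem_child_iff (s ⟨w, hw⟩).root_mem j).1 hm
            change i = t.numChildren w + j at h3
            omega
          · have h2 : w ++ [i] = (u.1 ++ (t.numChildren u.1 + j) :: v) ++ [k] := by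
              simpa using hwu
            have := (List.append_inj' h2 rfl).1
            rw [this] at hw
            exact absurd hw (t.not_child_prefix u.2)
      · by_cases h : i < t.numChildren w
        · exact Or.inl ((t.mem_child_iff hw i).2 h)
        · refine Or.inr ⟨⟨w, hw⟩, i - t.numChildren w, [], ?_, ?_⟩
          · change w ++ [i] = w ++ [t.numChildren w + (i - t.numChildren w)]
            rw [Nat.add_sub_cancel' (by omega)]
          · exact ((s ⟨w, hw⟩).mem_child_iff (s ⟨w, hw⟩).root_mem _).2 (by omega)
    · obtain ⟨c, hc⟩ := (s u).children (j :: v) hm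
      refine ⟨c, fun i => ⟨?_, fun hi =>
        Or.inr ⟨u, j, v ++ [i], by simp, by simpa using (hc i).2 hi⟩⟩⟩
      rintro (h | ⟨u', j', v', hwu, hm'⟩)
      · exact absurd (t.prefix_mem h) (t.not_child_prefix u.2)
      · have h2 : u.1 ++ (t.numChildren u.1 + j) :: (v ++ [i])
            = u'.1 ++ (t.numChildren u'.1 + j') :: v' := by simpa using hwu
        obtain ⟨h3, rfl, rfl⟩ := t.graft_decomp u.2 u'.2 h2
        obtain rfl : u = u' := Subtype.ext h3
        exact (hc i).1 (by simpa using hm')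

/-- The infinite branch `b_∞`: its vertices are `v_n = 00…0` (`n` letters), `n ≥ 0`. -/
def infiniteBranch : PlaneTree where
  verts := {u | ∃ n : ℕ, u = List.replicate n 0}
  root_mem := ⟨0, rfl⟩
  parent_mem u i h := by
    obtain ⟨n, hn⟩ := h
    exact ⟨u.length, List.eq_replicate_iff.2 ⟨rfl, fun b hb =>
      (List.eq_replicate_iff.1 hn).2 b (by simp [hb])⟩⟩
  children u hu := by
    obtain ⟨n, rfl⟩ := hu
    refine ⟨1, fun i => ⟨?_, fun hi => ⟨n + 1, ?_⟩⟩⟩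
    · rintro ⟨m, hm⟩
      have := (List.eq_replicate_iff.1 hm).2 i (by simp)
      omega
    · obtain rfl : i = 0 := by omega
      rw [List.replicate_succ']

end PlaneTree

/-- Unordered rooted trees: equivalence classes of plane trees. -/
def UTree : Type := Quotient PlaneTree.setoid

namespace UTree

/-- The unordered tree underlying a plane tree. -/
def mk (t : PlaneTree) : UTree := Quotient.mk PlaneTree.setoid t

/-- The closed ball `τ|_R` centred at the root. -/
def trunc (R : ℕ) : UTree → UTree :=
  Quotient.map (PlaneTree.trunc R) (fun _ _ h => PlaneTree.Equivalent.trunc h R)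

open Classical in
/-- The local distance `exp (-inf {R ≥ 0 : τ|_R ≠ σ|_R})`, with `inf ∅ = ∞` and `exp (-∞) = 0`. -/
def locDist (τ σ : UTree) : ℝ :=
  if ∀ R : ℕ, τ.trunc R = σ.trunc R then 0
  else Real.exp (-((sInf {R : ℕ | τ.trunc R ≠ σ.trunc R} : ℕ) : ℝ))

theorem locDist_self (τ : UTree) : locDist τ τ = 0 := by simp [locDist]

theorem locDist_comm (τ σ : UTree) : locDist τ σ = locDist σ τ := by
  have h : (∀ R : ℕ, τ.trunc R = σ.trunc R) ↔ ∀ R : ℕ, σ.trunc R = τ.trunc R :=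
    forall_congr' fun R => eq_comm
  have h2 : {R : ℕ | τ.trunc R ≠ σ.trunc R} = {R : ℕ | σ.trunc R ≠ τ.trunc R} :=
    Set.ext fun R => ne_comm
  unfold locDist
  rw [h2]
  by_cases h3 : ∀ R : ℕ, τ.trunc R = σ.trunc R
  · rw [if_pos h3, if_pos (h.1 h3)]
  · rw [if_neg h3, if_neg (fun h4 => h3 (h.2 h4))]

theorem locDist_nonneg (τ σ : UTree) : 0 ≤ locDist τ σ := by
  unfold locDist
  split_ifs
  · exact le_rfl
  · exact (Real.exp_pos _).le

theorem exp_le_locDist {τ σ : UTree} {R : ℕ} (h : τ.trunc R ≠ σ.trunc R) :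
    Real.exp (-(R : ℝ)) ≤ locDist τ σ := by
  unfold locDist
  rw [if_neg (fun hc => h (hc R))]
  have : sInf {R : ℕ | τ.trunc R ≠ σ.trunc R} ≤ R := Nat.sInf_le h
  gcongr

theorem locDist_le_max (τ σ ρ : UTree) : locDist τ ρ ≤ max (locDist τ σ) (locDist σ ρ) := by
  by_cases h : ∀ R : ℕ, τ.trunc R = ρ.trunc R
  · rw [locDist, if_pos h]
    exact le_max_of_le_left (locDist_nonneg _ _)
  · rw [locDist, if_neg h]
    have hne : {R : ℕ | τ.trunc R ≠ ρ.trunc R}.Nonempty := by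
      push Not at h; exact h
    have hm : τ.trunc (sInf {R : ℕ | τ.trunc R ≠ ρ.trunc R}) ≠ _ := Nat.sInf_mem hne
    by_cases h2 : τ.trunc (sInf {R : ℕ | τ.trunc R ≠ ρ.trunc R})
        = σ.trunc (sInf {R : ℕ | τ.trunc R ≠ ρ.trunc R})
    · exact le_max_of_le_right (exp_le_locDist (fun h3 => hm (h2.trans h3)))
    · exact le_max_of_le_left (exp_le_locDist h2)

/-- The topology of local convergence is the one given by the distance `locDist`. (It is in fact
a separated ultra-metric, since vertices have finitely many children; only its topology matters
for weak convergence.) -/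
instance : PseudoMetricSpace UTree where
  dist := locDist
  dist_self := locDist_self
  dist_comm := locDist_comm
  dist_triangle τ σ ρ := (locDist_le_max τ σ ρ).trans
    (max_le_add_of_nonneg (locDist_nonneg _ _) (locDist_nonneg _ _))

instance : MeasurableSpace UTree := borel UTree

instance : BorelSpace UTree := ⟨rfl⟩

/-- The set of finite trees with `n` vertices. -/
def withVertices (n : ℕ) : Set UTree :=
  {τ | ∃ t : PlaneTree, mk t = τ ∧ t.verts.Finite ∧ t.verts.ncard = n}

/-- The set of finite trees with `n` leaves. -/
def withLeaves (n : ℕ) : Set UTree :=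
  {τ | ∃ t : PlaneTree, mk t = τ ∧ t.verts.Finite ∧ t.leaves.ncard = n}

/-- Concatenation of unordered trees (the choice of plane representatives is irrelevant). -/
def concat {p : ℕ} (τ : Fin p → UTree) : UTree :=
  mk (PlaneTree.concat (fun i => (τ i).out))

/-- The tree `b_∞ ⨂_{n ≥ 0} (v_n, τ_n)` obtained by grafting `τ_n` on the infinite branch at
height `n`, for every `n` (the choice of plane representatives is irrelevant). -/
def graftOnBranch (τ : ℕ → UTree) : UTree :=
  mk (PlaneTree.infiniteBranch.graft (fun u => (τ u.1.length).out))

end UTree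

/-- The Galton-Watson law `GW_ξ` on unordered trees: a finite tree `τ` has mass
`∑_{t ∼ τ} ∏_{u ∈ t} ξ(c_u(t))`, the sum being over plane trees `t` in the class `τ`. -/
def gw (ξ : PMF ℕ) : Measure UTree :=
  Measure.sum (fun t : {t : PlaneTree // t.verts.Finite} =>
    (∏ u ∈ t.2.toFinset, ξ (t.1.numChildren u)) • Measure.dirac (UTree.mk t.1))

/-- `GW_ξ` conditioned on the set of trees with `n` vertices. -/
def gwVertices (ξ : PMF ℕ) (n : ℕ) : Measure UTree :=
  ProbabilityTheory.cond (gw ξ) (UTree.withVertices n)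

/-- `GW_ξ` conditioned on the set of trees with `n` leaves. -/
def gwLeaves (ξ : PMF ℕ) (n : ℕ) : Measure UTree :=
  ProbabilityTheory.cond (gw ξ) (UTree.withLeaves n)

/-- The size-biased distribution `k ↦ k ξ(k)`. -/
def sizeBiased (ξ : PMF ℕ) : Measure ℕ :=
  Measure.sum (fun k : ℕ => ((k : ℝ≥0∞) * ξ k) • Measure.dirac k)

/-- The law `GW_ξ^∞` of Kesten's tree, i.e. of `b_∞ ⨂_{n ≥ 0} (v_n, ⟦T_{n,1}, …, T_{n,X_n}⟧)`
where `X_n` (`n ≥ 0`) and `T_{n,k}` (`n ≥ 0`, `k ≥ 1`, here numbered from `0`) are all independent,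
`X_n + 1` has the size-biased law and `T_{n,k}` has law `GW_ξ`. -/
def kesten (ξ : PMF ℕ) : Measure UTree :=
  ((Measure.infinitePi (fun _ : ℕ => (sizeBiased ξ).map (fun k => k - 1))).prod
    (Measure.infinitePi (fun _ : ℕ × ℕ => gw ξ))).map
    (fun ω : (ℕ → ℕ) × (ℕ × ℕ → UTree) => UTree.graftOnBranch (fun n =>
      UTree.concat (fun k : Fin (ω.1 n) => ω.2 (n, (k : ℕ)))))

end

/-! Both conditionings fix the number of vertices whose out-degree lies in a set `A` containing 0:
`A = Set.univ` counts vertices, `A = {0}` counts leaves. All limits below are probability measures,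
so by the portmanteau theorem it is enough to bound from below, asymptotically, the conditioned mass
of events that depend on a ball of radius `R`; no upper bound is needed.

Kesten's law is self-similar: the root has `m + 1` children with probability `(m + 1) ξ (m + 1)`,
one subtree is again a Kesten tree and the other `m` are independent Galton–Watson trees
(`lintegral_kesten_eq`). A large Galton–Watson tree imitates this. Keep only the trees in which one
root subtree has more than half of the total count of the root subtrees. By symmetry this costs
exactly the factor `m + 1` when the dominant subtree is put first (`mul_tsum_dominant_le`). With
finitely many fixed siblings and `n` large, dominance is automatic, and the first subtree is a
Galton–Watson tree conditioned on a count `n - d`, with `d` constant. Induction on `R` then gives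
the bound (`eventually_mul_treeMass_le_treeSum`), provided that the probability `p n` of the count
`n` satisfies `liminf p (n - d) / p n ≥ 1`.

That ratio limit theorem is the analytic core. The generating series satisfies `F = X H(F)`, where
`H` has nonnegative coefficients of sum at most 1, so Lagrange inversion expresses `p (n + 1)`
through the coefficient of `X ^ n` in `H ^ (n + 1)`. Consecutive powers of `H ^ d` are compared by
counting the factors that contribute `X ^ d`; a Chernoff bound controls this up to an exponentially
small error (`coeff_pow_succ_sub_le`). Criticality makes the error negligible: the total mass is 1,
the radius of convergence of `F` is at most 1, and hence the positive coefficients cannot decay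
exponentially (`exists_pow_le_coeff`). -/

noncomputable section

/-! ### Power series with nonnegative coefficients of bounded sum -/

/-- Partial sums of the coefficients of a real power series. -/
def coeffSum (B : PowerSeries ℝ) (N : ℕ) : ℝ := ∑ i ∈ Finset.range N, B.coeff i

/-- The power series has nonnegative coefficients, whose sum is at most `s`. -/
structure CoeffSumLE (B : PowerSeries ℝ) (s : ℝ) : Prop where
  nonneg : ∀ n, 0 ≤ B.coeff n
  sum_le : ∀ N, coeffSum B N ≤ s

theorem coeff_mul_nonneg {B P : PowerSeries ℝ} (hB : ∀ n, 0 ≤ B.coeff n)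
    (hP : ∀ n, 0 ≤ P.coeff n) (n : ℕ) : 0 ≤ (B * P).coeff n := by
  rw [PowerSeries.coeff_mul]
  exact Finset.sum_nonneg fun p _ => mul_nonneg (hB _) (hP _)

theorem coeff_mul_coeff_le {B P : PowerSeries ℝ} (hB : ∀ n, 0 ≤ B.coeff n)
    (hP : ∀ n, 0 ≤ P.coeff n) (i j : ℕ) :
    B.coeff i * P.coeff j ≤ (B * P).coeff (i + j) := by
  rw [PowerSeries.coeff_mul]
  exact Finset.single_le_sum (f := fun p : ℕ × ℕ => B.coeff p.1 * P.coeff p.2)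
    (fun p _ => mul_nonneg (hB _) (hP _))
    (Finset.HasAntidiagonal.mem_antidiagonal.2 rfl :
      (i, j) ∈ Finset.HasAntidiagonal.antidiagonal (i + j))

theorem coeff_pow_nonneg {B : PowerSeries ℝ} (hB : ∀ n, 0 ≤ B.coeff n) (k n : ℕ) :
    0 ≤ (B ^ k).coeff n := by
  induction k generalizing n with
  | zero => rw [pow_zero, PowerSeries.coeff_one]; split_ifs <;> norm_num
  | succ k ih => rw [pow_succ]; exact coeff_mul_nonneg ih hB n

theorem coeffSum_nonneg {B : PowerSeries ℝ} (hB : ∀ n, 0 ≤ B.coeff n) (N : ℕ) :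
    0 ≤ coeffSum B N := Finset.sum_nonneg fun _ _ => hB _

/-- Multiplied out, the left side runs over the pairs of exponents with `p.1 + p.2 < N`, which lie
in the square of pairs below `N`. -/
theorem coeffSum_mul_le {B P : PowerSeries ℝ} (hB : ∀ n, 0 ≤ B.coeff n)
    (hP : ∀ n, 0 ≤ P.coeff n) (N : ℕ) :
    coeffSum (B * P) N ≤ coeffSum B N * coeffSum P N := by
  unfold coeffSum
  rw [Finset.sum_mul_sum, ← Finset.sum_product']
  refine le_trans (le_of_eq ?_) (Finset.sum_le_sum_of_subset_of_nonneg
    (Finset.filter_subset (fun p : ℕ × ℕ => p.1 + p.2 < N) _)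
    fun p _ _ => mul_nonneg (hB _) (hP _))
  rw [← Finset.sum_fiberwise_of_maps_to (g := fun p : ℕ × ℕ => p.1 + p.2) (t := Finset.range N)
    (fun p hp => by simpa using (Finset.mem_filter.1 hp).2)]
  refine Finset.sum_congr rfl fun n hn => ?_
  rw [PowerSeries.coeff_mul]
  refine Finset.sum_congr ?_ fun _ _ => rfl
  ext ⟨a, b⟩
  simp only [Finset.HasAntidiagonal.mem_antidiagonal, Finset.mem_filter, Finset.mem_product, Finset.mem_range] at *
  omega

theorem CoeffSumLE.coeff_le {B : PowerSeries ℝ} {s : ℝ} (h : CoeffSumLE B s) (n : ℕ) :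
    B.coeff n ≤ s :=
  (Finset.single_le_sum (f := fun i => B.coeff i) (fun _ _ => h.nonneg _)
    (Finset.self_mem_range_succ n)).trans (h.sum_le (n + 1))

theorem CoeffSumLE.bound_nonneg {B : PowerSeries ℝ} {s : ℝ} (h : CoeffSumLE B s) : 0 ≤ s :=
  (h.nonneg 0).trans (h.coeff_le 0)

theorem CoeffSumLE.mul {B P : PowerSeries ℝ} {s t : ℝ} (hB : CoeffSumLE B s)
    (hP : CoeffSumLE P t) : CoeffSumLE (B * P) (s * t) where
  nonneg := coeff_mul_nonneg hB.nonneg hP.nonneg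
  sum_le N := (coeffSum_mul_le hB.nonneg hP.nonneg N).trans
    (mul_le_mul (hB.sum_le N) (hP.sum_le N) (coeffSum_nonneg hP.nonneg N) hB.bound_nonneg)

theorem CoeffSumLE.pow {B : PowerSeries ℝ} {s : ℝ} (hB : CoeffSumLE B s) (k : ℕ) :
    CoeffSumLE (B ^ k) (s ^ k) := by
  induction k with
  | zero =>
    refine ⟨coeff_pow_nonneg hB.nonneg 0, fun N => ?_⟩
    rw [pow_zero, pow_zero, coeffSum]
    simp only [PowerSeries.coeff_one]
    rw [Finset.sum_ite_eq']
    split_ifs <;> norm_num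
  | succ k ih => rw [pow_succ, pow_succ]; exact ih.mul hB

/-! ### Lagrange inversion -/

open PowerSeries in
/-- Lagrange inversion for the powers of a solution of `F = X H(F)`. -/
theorem lagrange_inversion {F H : PowerSeries ℝ} (h0 : F.constantCoeff = 0)
    (hF : F = X * H.subst F) (n k : ℕ) :
    ((n + k : ℕ) : ℝ) * (F ^ k).coeff (n + k) = k * (H ^ (n + k)).coeff n := by
  have hs : HasSubst F := HasSubst.of_constantCoeff_zero' h0
  induction hN : n + k using Nat.strong_induction_on generalizing n k with
  | _ N ih =>
  subst hN
  rcases Nat.eq_zero_or_pos k with rfl | hk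
  · rcases Nat.eq_zero_or_pos n with rfl | hn
    · simp
    · simp [PowerSeries.coeff_one, hn.ne']
  have e1 : F ^ k = (H ^ k).subst F * X ^ k := by
    conv_lhs => rw [hF]
    rw [mul_pow, subst_pow hs, mul_comm]
  have e2 : (F ^ k).coeff (n + k) = PowerSeries.coeff n ((H ^ k).subst F : PowerSeries ℝ) := by
    rw [e1, coeff_mul_X_pow]
  -- The case `n = 0` is separate because the general argument ends by cancelling a factor `n`.
  rcases Nat.eq_zero_or_pos n with rfl | hn
  · rw [e2, coeff_subst' hs, finsum_eq_single _ 0]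
    · simp
    · intro i hi
      simp [h0, hi]
  have hFi : ∀ i, n < i → (F ^ i).coeff n = 0 := fun i hi =>
    coeff_of_lt_order _ (lt_of_lt_of_le (by exact_mod_cast hi)
      (le_order_pow_of_constantCoeff_eq_zero i h0))
  have e3 : (F ^ k).coeff (n + k) = ∑ i ∈ Finset.range (n + 1), (H ^ k).coeff i * (F ^ i).coeff n := by
    rw [e2, coeff_subst' hs]
    simp only [smul_eq_mul]
    refine finsum_eq_sum_of_support_subset _ fun i hi => ?_
    by_contra hc
    simp only [Finset.coe_range, Set.mem_Iio, not_lt] at hc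
    exact hi (by simp only; rw [hFi i (by omega), mul_zero])
  -- Each `(F ^ i).coeff n` is an instance of the claim with total `n < n + k`; the factor `i` that
  -- it produces is the one created by `X * d/dX`.
  have e4 : (n : ℝ) * (F ^ k).coeff (n + k)
      = (X * derivative ℝ (H ^ k) * H ^ n).coeff n := by
    rw [e3, Finset.mul_sum, coeff_mul, Finset.Nat.sum_antidiagonal_eq_sum_range_succ_mk]
    refine Finset.sum_congr rfl fun i hi => ?_
    have hi : i ≤ n := by simpa [Nat.lt_succ_iff] using hi
    have h5 := ih n (by omega) (n - i) i (by omega)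
    have h6 : (X * derivative ℝ (H ^ k)).coeff i = (H ^ k).coeff i * i := by
      cases i with
      | zero => simp
      | succ i => rw [coeff_succ_X_mul, coeff_derivative]; simp
    change _ = (X * derivative ℝ (H ^ k)).coeff i * (H ^ n).coeff (n - i)
    rw [h6]
    linear_combination (H ^ k).coeff i * h5
  -- Both sides equal `(n + k) k X H' H ^ (n + k - 1)`.
  have e5 : ((n + k : ℕ) : PowerSeries ℝ) * (X * derivative ℝ (H ^ k) * H ^ n)
      = (k : PowerSeries ℝ) * (X * derivative ℝ (H ^ (n + k))) := by
    obtain ⟨k, rfl⟩ : ∃ j, k = j + 1 := ⟨k - 1, by omega⟩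
    simp only [derivative_pow, Nat.add_sub_cancel]
    rw [← Nat.add_assoc, Nat.add_sub_cancel, pow_add]
    ring
  have e6 := congrArg (coeff n) e5
  rw [← map_natCast (C (R := ℝ)), ← map_natCast (C (R := ℝ)), coeff_C_mul, coeff_C_mul, ← e4] at e6
  obtain ⟨m, rfl⟩ : ∃ j, n = j + 1 := ⟨n - 1, by omega⟩
  rw [coeff_succ_X_mul, coeff_derivative] at e6
  have : ((m : ℝ) + 1) ≠ 0 := by positivity
  refine mul_left_cancel₀ this ?_
  push_cast at e6 ⊢
  linear_combination e6

/-! ### Ratio limit theorem for the diagonal coefficients of powers -/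

/-- Replacing the coefficient `b` of `X ^ j` by `θ b`, `θ ≤ 1`, in a series whose coefficients sum to
at most `1`. -/
theorem CoeffSumLE.sub_monomial {B : PowerSeries ℝ} (hB : CoeffSumLE B 1) (j : ℕ) {ε : ℝ}
    (h1 : ε ≤ 1) :
    CoeffSumLE (B - PowerSeries.monomial j (ε * B.coeff j)) (1 - ε * B.coeff j) := by
  have hnn : ∀ n, 0 ≤ (B - PowerSeries.monomial j (ε * B.coeff j)).coeff n := fun n => by
    rw [map_sub, PowerSeries.coeff_monomial]
    split_ifs with h
    · subst h
      nlinarith [hB.nonneg n]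
    · simpa using hB.nonneg n
  refine ⟨hnn, fun N => ?_⟩
  -- The range is enlarged past `j` so that the subtracted monomial is counted in full.
  have h2 : coeffSum (B - PowerSeries.monomial j (ε * B.coeff j)) N
      ≤ coeffSum (B - PowerSeries.monomial j (ε * B.coeff j)) (max N (j + 1)) :=
    Finset.sum_le_sum_of_subset_of_nonneg (Finset.range_mono (le_max_left _ _))
      fun _ _ _ => hnn _
  refine h2.trans ?_
  have h3 := hB.sum_le (max N (j + 1))
  unfold coeffSum at h3 ⊢
  simp_rw [map_sub, PowerSeries.coeff_monomial]
  rw [Finset.sum_sub_distrib, Finset.sum_ite_eq' ,if_pos (by simp)]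
  linarith

/-- Comparison of consecutive powers: by a Chernoff bound, the number of factors of `B ^ (q + 1)`
that contribute `X ^ j` is at least `a (q + 1)`, up to an exponentially small error, for every
`a` below the coefficient of `X ^ j` in `B`. -/
theorem coeff_pow_succ_sub_le {B : PowerSeries ℝ} (hB : CoeffSumLE B 1) {j : ℕ} {a : ℝ}
    (ha0 : 0 < a) (ha : a < B.coeff j) :
    ∃ κ : ℝ, 0 < κ ∧ κ < 1 ∧ ∀ P : PowerSeries ℝ, CoeffSumLE P 1 → ∀ q i : ℕ,
      a * ((B ^ (q + 1) * P).coeff (i + j) - κ ^ (q + 1)) ≤ B.coeff j * (B ^ q * P).coeff i := by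
  set b := B.coeff j with hb
  have hb1 : b ≤ 1 := hB.coeff_le j
  -- Since `1 - exp (-lam) ≥ lam / (1 + lam)`, the condition `a (1 + lam) < b` gives `lam a < (1 -
  -- θ) b`, which is what makes the Chernoff rate `β exp (lam a)` smaller than 1.
  obtain ⟨lam, hl0, hl⟩ : ∃ lam : ℝ, 0 < lam ∧ a * (1 + lam) < b := by
    refine ⟨(b / a - 1) / 2, ?_, ?_⟩
    · have : 1 < b / a := (one_lt_div ha0).2 ha
      linarith
    · have : a * (b / a) = b := by field_simp
      nlinarith
  set θ := Real.exp (-lam) with hθ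
  have hθ0 : 0 < θ := Real.exp_pos _
  have hθ1 : θ < 1 := by rw [hθ, Real.exp_lt_one_iff]; linarith
  set β := 1 - (1 - θ) * b with hβ
  have hβ0 : 0 < β := by nlinarith
  have hκ1 : β * Real.exp (lam * a) < 1 := by
    have h1 : β ≤ Real.exp (-((1 - θ) * b)) := by
      have := Real.add_one_le_exp (-((1 - θ) * b)); linarith
    have h2 : lam / (1 + lam) ≤ 1 - θ := by
      have h3 : θ ≤ 1 / (1 + lam) := by
        rw [hθ, Real.exp_neg, ← one_div]
        exact one_div_le_one_div_of_le (by linarith) (by have := Real.add_one_le_exp lam; linarith)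
      have h4 : lam / (1 + lam) = 1 - 1 / (1 + lam) := by field_simp; ring
      linarith
    have h5 : lam * a < (1 - θ) * b := by
      have h6 : lam * a < lam / (1 + lam) * b := by
        rw [div_mul_eq_mul_div, lt_div_iff₀ (by linarith)]
        nlinarith
      have h7 : lam / (1 + lam) * b ≤ (1 - θ) * b := by
        apply mul_le_mul_of_nonneg_right h2; linarith
      linarith
    calc β * Real.exp (lam * a) ≤ Real.exp (-((1 - θ) * b)) * Real.exp (lam * a) := by gcongr
      _ = Real.exp (-((1 - θ) * b) + lam * a) := (Real.exp_add _ _).symm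
      _ < 1 := by rw [Real.exp_lt_one_iff]; linarith
  refine ⟨β * Real.exp (lam * a), by positivity, hκ1, fun P hP q i => ?_⟩
  set Y : PowerSeries ℝ := PowerSeries.monomial j b with hY
  set Z := B - Y with hZ
  have hZnn : ∀ n, 0 ≤ Z.coeff n := by
    have := (hB.sub_monomial j (ε := 1) le_rfl).nonneg
    rw [one_mul] at this; exact this
  have hYnn : ∀ n, 0 ≤ Y.coeff n := fun n => by
    rw [hY, PowerSeries.coeff_monomial]; split_ifs
    · linarith
    · exact le_rfl
  have hD : CoeffSumLE (PowerSeries.C θ * Y + Z) β := by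
    have h := hB.sub_monomial j (ε := 1 - θ) (by linarith)
    have e : PowerSeries.C θ * Y + Z = B - PowerSeries.monomial j ((1 - θ) * B.coeff j) := by
      ext n
      simp only [hZ, hY, map_add, map_sub, PowerSeries.coeff_C_mul, PowerSeries.coeff_monomial]
      split_ifs <;> ring
    rw [e]; exact h
  set N := q + 1 with hN
  -- `T r` collects the terms of `B ^ N * P` in which exactly `r` of the `N` factors contribute the
  -- monomial `Y`.
  set T : ℕ → ℝ := fun r => (Y ^ r * Z ^ (N - r) * (N.choose r : PowerSeries ℝ) * P).coeff (i + j)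
    with hT
  have hTnn : ∀ r, 0 ≤ T r := fun r => by
    refine coeff_mul_nonneg (coeff_mul_nonneg (coeff_mul_nonneg (coeff_pow_nonneg hYnn _)
      (coeff_pow_nonneg hZnn _)) fun n => ?_) hP.nonneg _
    rw [← map_natCast (PowerSeries.C (R := ℝ)), PowerSeries.coeff_C]
    split_ifs <;> positivity
  have hBsum : (B ^ N * P).coeff (i + j) = ∑ r ∈ Finset.range (N + 1), T r := by
    have : B = Y + Z := by rw [hZ]; ring
    rw [this, add_pow, Finset.sum_mul, map_sum]
  have hDsum : ((PowerSeries.C θ * Y + Z) ^ N * P).coeff (i + j)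
      = ∑ r ∈ Finset.range (N + 1), θ ^ r * T r := by
    rw [add_pow, Finset.sum_mul, map_sum]
    refine Finset.sum_congr rfl fun r _ => ?_
    rw [hT, mul_pow, ← map_pow, ← PowerSeries.coeff_C_mul]
    congr 1; ring
  -- Double counting: marking one factor that contributes `Y` weights each term by the number `r` of
  -- such factors, while the remaining `q` factors are free.
  have hcount : (N : ℝ) * (b * (B ^ q * P).coeff i) = ∑ r ∈ Finset.range (N + 1), (r : ℝ) * T r := by
    have e1 : b * (B ^ q * P).coeff i = (Y * (B ^ q * P)).coeff (i + j) := by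
      rw [hY]
      have : (PowerSeries.monomial j b : PowerSeries ℝ) = PowerSeries.C b * PowerSeries.X ^ j := by
        rw [PowerSeries.X_pow_eq, ← PowerSeries.smul_eq_C_mul, ← LinearMap.map_smul]; simp
      rw [this, mul_assoc, PowerSeries.coeff_C_mul, mul_comm (PowerSeries.X ^ j),
        PowerSeries.coeff_mul_X_pow]
    have : B = Y + Z := by rw [hZ]; ring
    rw [e1, this, add_pow, Finset.sum_range_succ' _ N]
    simp only [Nat.cast_zero, zero_mul, add_zero]
    rw [Finset.sum_mul, Finset.mul_sum, map_sum, Finset.mul_sum, hN]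
    refine Finset.sum_congr rfl fun r hr => ?_
    rw [hT, ← PowerSeries.coeff_C_mul, ← PowerSeries.coeff_C_mul]
    congr 1
    have h1 : ((q + 1 : ℕ) : PowerSeries ℝ) * (q.choose r : PowerSeries ℝ)
        = ((q + 1).choose (r + 1) : PowerSeries ℝ) * ((r + 1 : ℕ) : PowerSeries ℝ) := by
      rw [← Nat.cast_mul, ← Nat.cast_mul, Nat.add_one_mul_choose_eq q r]
    rw [map_natCast, map_natCast, pow_succ, hN, Nat.add_sub_add_right]
    linear_combination Y ^ r * Y * Z ^ (q - r) * P * h1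
  have hbound : (∑ r ∈ Finset.range (N + 1), θ ^ r * T r) ≤ β ^ N := by
    rw [← hDsum]
    simpa using ((hD.pow N).mul hP).coeff_le (i + j)
  have hNpos : (0 : ℝ) < N := by rw [hN]; positivity
  -- If `r ≥ a N`, the factor `r` suffices; otherwise `exp (lam a N) θ ^ r ≥ 1` and the left side is
  -- nonpositive.
  have hterm : ∀ r : ℕ, a * N * (T r - Real.exp (lam * a * N) * (θ ^ r * T r)) ≤ r * T r := by
    intro r
    have e : Real.exp (lam * a * N) * (θ ^ r * T r) = Real.exp (lam * (a * N - r)) * T r := by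
      rw [hθ, ← Real.exp_nat_mul, ← mul_assoc, ← Real.exp_add]; ring_nf
    rw [e]
    have h := Real.exp_pos (lam * (a * N - r))
    rcases le_total (a * N) r with h1 | h1
    · have : 0 ≤ Real.exp (lam * (a * N - r)) * T r := mul_nonneg h.le (hTnn r)
      have h2 : 0 < a * N := by positivity
      nlinarith [hTnn r]
    · have h2 : 1 ≤ Real.exp (lam * (a * N - r)) :=
        Real.one_le_exp (mul_nonneg hl0.le (by linarith))
      have h3 : T r ≤ Real.exp (lam * (a * N - r)) * T r := by nlinarith [hTnn r]
      have h2 : 0 < a * N := by positivity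
      have h4 : (0 : ℝ) ≤ r * T r := mul_nonneg (Nat.cast_nonneg _) (hTnn r)
      nlinarith
  have hfin : a * N * ((B ^ N * P).coeff (i + j) - Real.exp (lam * a * N) * β ^ N)
      ≤ N * (b * (B ^ q * P).coeff i) := by
    rw [hcount, hBsum]
    refine le_trans ?_ (Finset.sum_le_sum fun r _ => hterm r)
    rw [← Finset.mul_sum, Finset.sum_sub_distrib, ← Finset.mul_sum]
    gcongr
  have e2 : (β * Real.exp (lam * a)) ^ N = Real.exp (lam * a * N) * β ^ N := by
    rw [mul_pow, ← Real.exp_nat_mul]; ring_nf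
  rw [e2]
  have : N * (a * ((B ^ N * P).coeff (i + j) - Real.exp (lam * a * N) * β ^ N))
      ≤ N * (b * (B ^ q * P).coeff i) := by linarith
  exact le_of_mul_le_mul_left this hNpos

/-- A sum of `n + 1` variables can be equal to `n` only if one of them vanishes. -/
theorem coeff_pow_succ_le {H : PowerSeries ℝ} (hH : CoeffSumLE H 1) (n : ℕ) :
    (H ^ (n + 1)).coeff n ≤ (n + 1) * (H ^ n).coeff n := by
  set c := H.coeff 0 with hc
  obtain ⟨Z, hZ⟩ : ∃ Z : PowerSeries ℝ, H = PowerSeries.C c + PowerSeries.X * Z := by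
    refine ⟨PowerSeries.mk fun n => H.coeff (n + 1), ?_⟩
    ext n
    cases n with
    | zero => simp [hc]
    | succ n => simp [PowerSeries.coeff_succ_X_mul]
  have hZnn : ∀ n, 0 ≤ (PowerSeries.X * Z).coeff n := fun n => by
    cases n with
    | zero => simp
    | succ n =>
      have := hH.nonneg (n + 1)
      rw [hZ, map_add, PowerSeries.coeff_C] at this
      simpa using this
  -- Union bound: in an expanded term either no factor contributes its constant term, or one of the
  -- `m` factors does, and this factor `c ≤ 1` is discarded. For `m = n + 1` and `i = n` the first
  -- alternative is void, since `X ^ (n + 1)` divides it.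
  have key : ∀ m i : ℕ, (H ^ m).coeff i ≤ ((PowerSeries.X * Z) ^ m).coeff i
      + m * (H ^ (m - 1)).coeff i := by
    intro m
    induction m with
    | zero => intro i; simp
    | succ m ih =>
      intro i
      have h1 : H ^ (m + 1) = PowerSeries.C c * H ^ m + PowerSeries.X * Z * H ^ m := by
        rw [pow_succ', ← add_mul, ← hZ]
      have hc1 : c ≤ 1 := hH.coeff_le 0
      have h2 : (PowerSeries.X * Z * H ^ m).coeff i
          ≤ ((PowerSeries.X * Z) ^ (m + 1)).coeff i + m * (H ^ m).coeff i := by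
        rcases Nat.eq_zero_or_pos m with rfl | hm
        · simp
        have h3 : (m : ℝ) * (PowerSeries.X * Z * H ^ (m - 1)).coeff i ≤ m * (H ^ m).coeff i := by
          refine mul_le_mul_of_nonneg_left ?_ (Nat.cast_nonneg _)
          obtain ⟨k, rfl⟩ : ∃ k, m = k + 1 := ⟨m - 1, by omega⟩
          have h4 : H ^ (k + 1) = PowerSeries.C c * H ^ k + PowerSeries.X * Z * H ^ k := by
            rw [pow_succ', ← add_mul, ← hZ]
          rw [h4, map_add, PowerSeries.coeff_C_mul, Nat.add_sub_cancel]
          have := mul_nonneg (hH.nonneg 0) (coeff_pow_nonneg hH.nonneg k i)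
          linarith
        refine le_trans ?_ (add_le_add_right h3 _)
        rw [pow_succ', PowerSeries.coeff_mul, PowerSeries.coeff_mul, PowerSeries.coeff_mul,
          Finset.mul_sum, ← Finset.sum_add_distrib]
        refine Finset.sum_le_sum fun p _ => ?_
        have := mul_le_mul_of_nonneg_left (ih p.2) (hZnn p.1)
        linarith
      rw [h1, map_add, PowerSeries.coeff_C_mul, Nat.add_sub_cancel]
      push_cast
      have := coeff_pow_nonneg hH.nonneg m i
      nlinarith
  have h := key (n + 1) n
  rw [mul_pow, PowerSeries.coeff_X_pow_mul', if_neg (by omega)] at h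
  push_cast at h
  simpa using h

/-- If the diagonal coefficients do not decay exponentially, then neither do the positive ones among
the coefficients of `X ^ n` in `H ^ (n + 1)`. -/
theorem exists_pow_le_coeff {H : PowerSeries ℝ} (hH : CoeffSumLE H 1) {ρ : ℝ} (h0 : 0 < ρ)
    (h1 : ρ < 1) (hu : ∃ m : ℕ, 1 ≤ m ∧ ρ ^ m ≤ (H ^ m).coeff m) :
    ∃ C : ℝ, 0 < C ∧ ∀ n : ℕ, 0 < (H ^ (n + 1)).coeff n → C * ρ ^ n ≤ (H ^ (n + 1)).coeff n := by
  obtain ⟨m, hm, hum⟩ := hu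
  -- Supermultiplicativity: `q` further factors `H ^ m` each add the degree `m` at a cost of at most
  -- `ρ ^ m`.
  have hiter : ∀ n q : ℕ, (H ^ (n + 1)).coeff n * ρ ^ (m * q)
      ≤ (H ^ (n + m * q + 1)).coeff (n + m * q) := by
    intro n q
    induction q with
    | zero => simp
    | succ q ih =>
      have e : H ^ (n + m * (q + 1) + 1) = H ^ (n + m * q + 1) * H ^ m := by ring
      have e2 : n + m * (q + 1) = (n + m * q) + m := by ring
      rw [e, e2]
      refine le_trans ?_ (coeff_mul_coeff_le (coeff_pow_nonneg hH.nonneg _)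
        (coeff_pow_nonneg hH.nonneg _) _ _)
      rw [Nat.mul_succ, pow_add ρ, ← mul_assoc]
      exact mul_le_mul ih hum (by positivity) (coeff_pow_nonneg hH.nonneg _ _)
  -- Within a residue class modulo `m`, the first positive coefficient propagates to all later ones
  -- by `hiter`; a class without positive coefficients imposes nothing.
  have hres : ∀ r : ℕ, ∃ C : ℝ, 0 < C ∧ ∀ n : ℕ, n % m = r → 0 < (H ^ (n + 1)).coeff n →
      C * ρ ^ n ≤ (H ^ (n + 1)).coeff n := by
    intro r
    classical
    by_cases h : ∃ n : ℕ, n % m = r ∧ 0 < (H ^ (n + 1)).coeff n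
    · obtain ⟨hs1, hs2⟩ := Nat.find_spec h
      refine ⟨_, hs2, fun n hn hpos => ?_⟩
      have hle : Nat.find h ≤ n := Nat.find_min' h ⟨hn, hpos⟩
      have hdvd : m ∣ n - Nat.find h := (Nat.modEq_iff_dvd' hle).1 (hs1.trans hn.symm)
      obtain ⟨q, hq⟩ := hdvd
      have e : n = Nat.find h + m * q := by omega
      have h3 := hiter (Nat.find h) q
      rw [← e] at h3
      refine le_trans ?_ h3
      refine mul_le_mul_of_nonneg_left ?_ hs2.le
      exact pow_le_pow_of_le_one h0.le h1.le (by omega)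
    · exact ⟨1, one_pos, fun n hn hpos => absurd ⟨n, hn, hpos⟩ h⟩
  choose C hC hCn using hres
  have hne : (Finset.range m).Nonempty := ⟨0, Finset.mem_range.2 hm⟩
  refine ⟨(Finset.range m).inf' hne C, (Finset.lt_inf'_iff hne).2 fun r _ => hC r,
    fun n hpos => ?_⟩
  refine le_trans ?_ (hCn (n % m) n rfl hpos)
  gcongr
  exact Finset.inf'_le _ (by simpa using Nat.mod_lt n hm)

/-- Strong ratio limit theorem, as a lower bound along a reachable shift `d`. -/
theorem eventually_mul_coeff_le {H : PowerSeries ℝ} (hH : CoeffSumLE H 1)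
    (hu : ∀ ρ : ℝ, 0 < ρ → ρ < 1 → ∃ m : ℕ, 1 ≤ m ∧ ρ ^ m ≤ (H ^ m).coeff m) {d : ℕ}
    (hd : 1 ≤ d) (hpos : 0 < (H ^ d).coeff d) {r : ℝ} (hr : r < 1) :
    ∀ᶠ n in atTop, r * (H ^ (n + d + 1)).coeff (n + d) ≤ (H ^ (n + 1)).coeff n := by
  wlog hr0 : 0 < r generalizing r
  · filter_upwards [this (r := 1 / 2) (by norm_num) (by norm_num)] with n hn
    have := coeff_pow_nonneg hH.nonneg (n + d + 1) (n + d)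
    push Not at hr0
    nlinarith
  set b := (H ^ d).coeff d with hb
  have hHd : CoeffSumLE (H ^ d) 1 := by simpa using hH.pow d
  set s := (1 + r) / 2 with hs
  obtain ⟨κ, hκ0, hκ1, hκ⟩ := coeff_pow_succ_sub_le hHd (j := d) (a := b * s)
    (mul_pos hpos (by linarith)) (by rw [← hb]; nlinarith)
  -- A rate strictly between `κ` and 1. Its `d`-th root `ρ` is the rate per unit of degree at which
  -- the coefficients are bounded below, so that `κ ^ (q + 1)` becomes negligible against them.
  set lam := (1 + κ) / 2 with hlam
  obtain ⟨ρ, hρ0, hρ1, hρ⟩ : ∃ ρ : ℝ, 0 < ρ ∧ ρ < 1 ∧ ρ ^ d = lam := by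
    refine ⟨lam ^ ((d : ℝ)⁻¹), Real.rpow_pos_of_pos (by linarith) _,
      Real.rpow_lt_one (by linarith) (by linarith) (by positivity), ?_⟩
    exact Real.rpow_inv_natCast_pow (by linarith) (by omega)
  obtain ⟨C, hC0, hC⟩ := exists_pow_le_coeff hH hρ0 hρ1 (hu ρ hρ0 hρ1)
  -- The relative error `1 - r / s` is what lowers the constant from `s` to `r`. The additional
  -- factor `lam` absorbs the remainder of the division by `d`, as `n + d ≤ d (q + 2)`.
  have hsmall : ∀ᶠ q : ℕ in atTop, κ ^ (q + 1) ≤ ((1 - r / s) * C * lam) * lam ^ (q + 1) := by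
    have hlim : Tendsto (fun q : ℕ => (κ / lam) ^ (q + 1)) atTop (𝓝 0) :=
      (tendsto_pow_atTop_nhds_zero_of_lt_one (div_nonneg hκ0.le (by linarith))
        ((div_lt_one (by linarith)).2 (by linarith))).comp (tendsto_add_atTop_nat 1)
    have hc : 0 < (1 - r / s) * C * lam := by
      have : r / s < 1 := (div_lt_one (by linarith)).2 (by linarith)
      have : 0 < 1 - r / s := by linarith
      have : 0 < lam := by linarith
      positivity
    filter_upwards [hlim.eventually (gt_mem_nhds hc)] with q hq
    rw [div_pow, div_lt_iff₀ (pow_pos (by linarith) _)] at hq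
    exact hq.le
  have hq : Tendsto (fun n : ℕ => (n + 1) / d) atTop atTop :=
    (Nat.tendsto_div_const_atTop (by omega)).comp (tendsto_add_atTop_nat 1)
  filter_upwards [hq.eventually hsmall] with n hn
  set q := (n + 1) / d with hqd
  set t := (n + 1) % d with ht
  have hnqt : n + 1 = d * q + t := (Nat.div_add_mod (n + 1) d).symm
  have e1 : H ^ (n + 1) = (H ^ d) ^ q * H ^ t := by rw [hnqt, pow_add, pow_mul]
  have e2 : H ^ (n + d + 1) = (H ^ d) ^ (q + 1) * H ^ t := by
    rw [← pow_mul, ← pow_add]; congr 1; rw [Nat.mul_succ]; omega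
  have hPt : CoeffSumLE (H ^ t) 1 := by simpa using hH.pow t
  have h1 := hκ (H ^ t) hPt q n
  rw [← e1, ← e2, ← hb] at h1
  rcases (coeff_pow_nonneg hH.nonneg (n + d + 1) (n + d)).eq_or_lt with h0 | hvpos
  · rw [← h0, mul_zero]; exact coeff_pow_nonneg hH.nonneg _ _
  have h2 := hC (n + d) hvpos
  set v := (H ^ (n + d + 1)).coeff (n + d) with hv
  have h3 : lam * lam ^ (q + 1) ≤ ρ ^ (n + d) := by
    rw [← pow_succ', ← hρ, ← pow_mul]
    refine pow_le_pow_of_le_one hρ0.le hρ1.le ?_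
    have := Nat.mod_lt (n + 1) hd
    rw [Nat.mul_succ, Nat.mul_succ]
    omega
  have hrs : r / s < 1 := (div_lt_one (by linarith)).2 (by linarith)
  have h4 : κ ^ (q + 1) ≤ (1 - r / s) * v := by
    calc κ ^ (q + 1) ≤ (1 - r / s) * (C * (lam * lam ^ (q + 1))) := by linarith
      _ ≤ (1 - r / s) * v := by
        refine mul_le_mul_of_nonneg_left (le_trans ?_ h2) (by linarith)
        gcongr
  have h5 : b * (r * v) ≤ b * (H ^ (n + 1)).coeff n := by
    refine le_trans ?_ h1
    have h6 : s * (r / s) = r := mul_div_cancel₀ r (by linarith)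
    have h7 : b * (r * v) = b * s * (v - (1 - r / s) * v) := by
      linear_combination (-b * v) * h6
    rw [h7]
    have : 0 < b * s := mul_pos hpos (by linarith)
    gcongr
  exact le_of_mul_le_mul_left h5 hpos

/-! ### From the functional equation to the ratio limit of its solution -/

open PowerSeries in
/-- A nonnegative solution of `H = G + K H` has coefficients summing to at most `1`, when `K 0 < 1`
and `G 1 + K 1 ≤ 1`. -/
theorem coeffSumLE_of_eq_add_mul {G K H : PowerSeries ℝ} (hG : ∀ n, 0 ≤ G.coeff n)
    (hK : ∀ n, 0 ≤ K.coeff n) (hG0 : 0 < G.coeff 0)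
    (hsum : ∀ N, coeffSum G N + coeffSum K N ≤ 1) (hH : H = G + K * H) : CoeffSumLE H 1 := by
  have hK0 : K.coeff 0 < 1 := by
    have := hsum 1
    simp only [coeffSum, Finset.sum_range_one] at this
    linarith
  have hnn : ∀ n, 0 ≤ H.coeff n := by
    intro n
    induction n using Nat.strong_induction_on with
    | _ n ih =>
    have h1 : H.coeff n = G.coeff n + (K * H).coeff n := by
      conv_lhs => rw [hH]
      rw [map_add]
    rw [PowerSeries.coeff_mul, Finset.Nat.sum_antidiagonal_eq_sum_range_succ_mk,
      Finset.sum_range_succ'] at h1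
    have h2 : 0 ≤ ∑ k ∈ Finset.range n, K.coeff (k + 1) * H.coeff (n - (k + 1)) :=
      Finset.sum_nonneg fun k hk => mul_nonneg (hK _)
        (ih _ (by have := Finset.mem_range.1 hk; omega))
    simp only [Nat.sub_zero] at h1
    have := hG n
    by_contra hneg
    push Not at hneg
    nlinarith
  refine ⟨hnn, fun N => ?_⟩
  rcases Nat.eq_zero_or_pos N with rfl | hN
  · simp [coeffSum]
  have h1 : coeffSum H N = coeffSum G N + coeffSum (K * H) N := by
    conv_lhs => rw [hH]
    simp only [coeffSum, map_add, Finset.sum_add_distrib]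
  have h2 := coeffSum_mul_le hK hnn N
  have h3 := hsum N
  have h4 : 0 < coeffSum G N := lt_of_lt_of_le hG0
    (Finset.single_le_sum (f := fun i => G.coeff i) (fun _ _ => hG _) (Finset.mem_range.2 hN))
  -- For the partial sums, `H ≤ G + K H` with `G > 0` and `G + K ≤ 1`; if `H > 1`, then `G + K H <
  -- (G + K) H ≤ H`, a contradiction.
  by_contra hneg
  push Not at hneg
  nlinarith

open PowerSeries in
/-- Ratio limit theorem for the number of vertices with out-degree in `A`, in terms of its generating
series `F`. -/
theorem eventually_mul_coeff_add_le {ξ : ℕ → ℝ} (hξ : ∀ k, 0 ≤ ξ k)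
    (hsum : ∀ N, ∑ k ∈ Finset.range N, ξ k ≤ 1) (h0 : 0 < ξ 0) {A : Set ℕ} (hA : 0 ∈ A)
    {F : PowerSeries ℝ} (hF0 : F.constantCoeff = 0)
    (hrec : ∀ n, F.coeff n = ∑ k ∈ Finset.range (n + 1),
      ξ k * (X ^ (A.indicator (fun _ => 1) k) * F ^ k : PowerSeries ℝ).coeff n)
    (hrad : ∀ ρ : ℝ, 0 < ρ → ρ < 1 → ∃ m : ℕ, 1 ≤ m ∧ ρ ^ m ≤ F.coeff (m + 1))
    {d : ℕ} (hd : 0 < F.coeff (d + 1)) {r : ℝ} (hr : r < 1) :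
    ∀ᶠ n in atTop, r * F.coeff (n + d) ≤ F.coeff n := by
  classical
  have hs : HasSubst F := HasSubst.of_constantCoeff_zero' hF0
  -- `G` gathers the out-degrees in `A` and `K` the others, shifted by one because `0 ∈ A` lets a
  -- factor `F` be taken out: `F = X G(F) + F K(F)`. Solving for `F` gives `F = X H(F)` with `H = G
  -- / (1 - K)`.
  set G : PowerSeries ℝ := PowerSeries.mk fun k => if k ∈ A then ξ k else 0 with hGdef
  set K : PowerSeries ℝ := PowerSeries.mk fun k => if k + 1 ∈ A then 0 else ξ (k + 1) with hKdef
  have hG : ∀ n, 0 ≤ G.coeff n := fun n => by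
    rw [hGdef, coeff_mk]; split_ifs <;> simp [hξ]
  have hK : ∀ n, 0 ≤ K.coeff n := fun n => by
    rw [hKdef, coeff_mk]; split_ifs <;> simp [hξ]
  have hG0 : 0 < G.coeff 0 := by rw [hGdef, coeff_mk, if_pos hA]; exact h0
  have hGK : ∀ N, coeffSum G N + coeffSum K N ≤ 1 := by
    intro N
    refine le_trans ?_ (hsum (N + 1))
    have h1 : coeffSum G N ≤ coeffSum G (N + 1) :=
      Finset.sum_le_sum_of_subset_of_nonneg (Finset.range_mono (Nat.le_succ N)) fun _ _ _ => hG _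
    have h2 : coeffSum G (N + 1) + coeffSum K N = ∑ k ∈ Finset.range (N + 1), ξ k := by
      rw [coeffSum, coeffSum, Finset.sum_range_succ', Finset.sum_range_succ', add_right_comm,
        ← Finset.sum_add_distrib]
      congr 1
      · refine Finset.sum_congr rfl fun k _ => ?_
        rw [hGdef, hKdef, coeff_mk, coeff_mk]
        split_ifs <;> simp
      · rw [hGdef, coeff_mk, if_pos hA]
    linarith
  have hK0 : constantCoeff (1 - K) ≠ 0 := by
    have := hGK 1
    simp only [coeffSum, Finset.sum_range_one] at this
    rw [map_sub, map_one, ← coeff_zero_eq_constantCoeff_apply]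
    intro h
    linarith
  set H : PowerSeries ℝ := G * (1 - K)⁻¹ with hHdef
  have hHK : H * (1 - K) = G := by
    rw [hHdef, mul_assoc, PowerSeries.inv_mul_cancel _ hK0, mul_one]
  have hHeq : H = G + K * H := by linear_combination hHK
  have hH : CoeffSumLE H 1 := coeffSumLE_of_eq_add_mul hG hK hG0 hGK hHeq
  have hFi : ∀ n i, n < i → (F ^ i).coeff n = 0 := fun n i hi =>
    coeff_of_lt_order _ (lt_of_lt_of_le (by exact_mod_cast hi)
      (le_order_pow_of_constantCoeff_eq_zero i hF0))
  have hsub : ∀ (B : PowerSeries ℝ) (n M : ℕ), n < M → PowerSeries.coeff n (B.subst F : PowerSeries ℝ)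
      = ∑ k ∈ Finset.range M, B.coeff k * (F ^ k).coeff n := by
    intro B n M hM
    rw [coeff_subst' hs]
    simp only [smul_eq_mul]
    refine finsum_eq_sum_of_support_subset _ fun i hi => ?_
    by_contra hc
    simp only [Finset.coe_range, Set.mem_Iio, not_lt] at hc
    exact hi (by simp only; rw [hFi n i (by omega), mul_zero])
  have hFeq : F = X * G.subst F + (X * K).subst F := by
    ext n
    rw [hrec n, map_add, hsub (X * K) n (n + 1) (by omega)]
    have e : PowerSeries.coeff n (X * G.subst F : PowerSeries ℝ)
        = ∑ k ∈ Finset.range (n + 1), G.coeff k * (X * F ^ k).coeff n := by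
      cases n with
      | zero => simp
      | succ n =>
        rw [coeff_succ_X_mul, hsub G n (n + 1 + 1) (by omega)]
        refine Finset.sum_congr rfl fun k _ => ?_
        rw [coeff_succ_X_mul]
    rw [e, ← Finset.sum_add_distrib]
    refine Finset.sum_congr rfl fun k _ => ?_
    cases k with
    | zero => simp [hGdef, hA]
    | succ k =>
      rw [coeff_succ_X_mul, hGdef, hKdef, coeff_mk, coeff_mk]
      by_cases hk : k + 1 ∈ A <;> simp [hk]
  have hFH : F = X * H.subst F := by
    have e1 : (X * K).subst F = F * K.subst F := by rw [subst_mul hs, subst_X hs]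
    have e2 : (H.subst F : PowerSeries ℝ) = G.subst F + K.subst F * H.subst F := by
      conv_lhs => rw [hHeq]
      rw [subst_add hs, subst_mul hs]
    rw [e1] at hFeq
    have e3 : (1 - K.subst F : PowerSeries ℝ) ≠ 0 := by
      intro h
      have h1 : constantCoeff (1 - K.subst F : PowerSeries ℝ) = 0 := by rw [h]; simp
      rw [map_sub, map_one, ← coeff_zero_eq_constantCoeff_apply, hsub K 0 1 one_pos] at h1
      rw [map_sub, map_one, ← coeff_zero_eq_constantCoeff_apply] at hK0
      apply hK0
      simpa using h1
    refine mul_right_cancel₀ e3 ?_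
    linear_combination hFeq - X * e2
  have hlag : ∀ n : ℕ, ((n : ℝ) + 1) * F.coeff (n + 1) = (H ^ (n + 1)).coeff n := by
    intro n
    have := lagrange_inversion hF0 hFH n 1
    simpa using this
  have hFu : ∀ n : ℕ, F.coeff (n + 1) ≤ (H ^ n).coeff n := fun n => by
    have h1 := coeff_pow_succ_le hH n
    rw [← hlag] at h1
    exact le_of_mul_le_mul_left h1 (by positivity)
  have hu : ∀ ρ : ℝ, 0 < ρ → ρ < 1 → ∃ m : ℕ, 1 ≤ m ∧ ρ ^ m ≤ (H ^ m).coeff m := by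
    intro ρ h1 h2
    obtain ⟨m, hm, hm2⟩ := hrad ρ h1 h2
    exact ⟨m, hm, hm2.trans (hFu m)⟩
  have hFnn : ∀ n, 0 ≤ F.coeff n := fun n => by
    cases n with
    | zero => simp [hF0]
    | succ n =>
      have h1 := coeff_pow_nonneg hH.nonneg (n + 1) n
      rw [← hlag] at h1
      exact nonneg_of_mul_nonneg_right h1 (by positivity)
  rcases Nat.eq_zero_or_pos d with rfl | hd1
  · refine Eventually.of_forall fun n => ?_
    simp only [add_zero]
    nlinarith [hFnn n]
  have hev := eventually_mul_coeff_le hH hu hd1 (hd.trans_le (hFu d)) hr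
  obtain ⟨N, hN⟩ := eventually_atTop.1 hev
  refine eventually_atTop.2 ⟨N + 1, fun n hn => ?_⟩
  obtain ⟨n, rfl⟩ : ∃ m, n = m + 1 := ⟨n - 1, by omega⟩
  have h1 := hN n (by omega)
  rw [← hlag, ← hlag] at h1
  have h2 := hFnn (n + d + 1)
  have h3 := hFnn (n + 1)
  rw [show n + 1 + d = n + d + 1 by ring]
  rcases le_total r 0 with hr0 | hr0
  · nlinarith
  -- The Lagrange factors `n + 1` and `n + d + 1` differ in the favourable direction.
  refine le_of_mul_le_mul_left (le_trans ?_ h1) (by positivity : (0 : ℝ) < (n : ℝ) + 1)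
  have h4 : (0 : ℝ) ≤ r * F.coeff (n + d + 1) := mul_nonneg hr0 h2
  push_cast
  nlinarith [mul_nonneg (Nat.cast_nonneg (α := ℝ) d) h4]

/-! ### Plane trees: decomposition at the root and invariance under equivalence -/

namespace PlaneTree

theorem mk_eq_mk_iff {t t' : PlaneTree} : UTree.mk t = UTree.mk t' ↔ t.Equivalent t' :=
  Quotient.eq (r := PlaneTree.setoid)

theorem trunc_trunc (t : PlaneTree) (R S : ℕ) : (t.trunc R).trunc S = t.trunc (min R S) := by
  ext u
  change (u ∈ t.verts ∧ u.length ≤ R) ∧ u.length ≤ S ↔ u ∈ t.verts ∧ u.length ≤ min R S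
  rw [le_min_iff, and_assoc]

/-- The subtree of the descendants of the `i`-th child of the root. -/
def subtree (t : PlaneTree) (i : Fin (t.numChildren [])) : PlaneTree where
  verts := {v | (i : ℕ) :: v ∈ t.verts}
  root_mem := (t.mem_child_iff t.root_mem i).2 i.2
  parent_mem u j h := t.parent_mem (i :: u) j h
  children u hu := t.children (i :: u) hu

theorem concat_subtree (t : PlaneTree) : concat t.subtree = t := by
  ext w
  rcases w with _ | ⟨i, v⟩
  · simp only [t.root_mem, (concat t.subtree).root_mem]
  · constructor
    · rintro (h | ⟨j, v', h, hm⟩)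
      · simp at h
      · obtain ⟨rfl, rfl⟩ := List.cons.inj h
        exact hm
    · intro h
      have hi : [i] ∈ t.verts := t.prefix_mem (u := [i]) (v := v) h
      exact Or.inr ⟨⟨i, (t.mem_child_iff t.root_mem i).1 hi⟩, v, rfl, h⟩

theorem cons_mem_concat {p : ℕ} (ts : Fin p → PlaneTree) (i : Fin p) (v : List ℕ) :
    (i : ℕ) :: v ∈ (concat ts).verts ↔ v ∈ (ts i).verts := by
  constructor
  · rintro (h | ⟨j, v', h, hm⟩)
    · simp at h
    · obtain ⟨h1, rfl⟩ := List.cons.inj h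
      obtain rfl := Fin.ext h1
      exact hm
  · exact fun h => Or.inr ⟨i, v, rfl, h⟩

theorem singleton_mem_concat {p : ℕ} (ts : Fin p → PlaneTree) (i : ℕ) :
    [i] ∈ (concat ts).verts ↔ i < p := by
  constructor
  · rintro (h | ⟨j, v, h, -⟩)
    · simp at h
    · rw [(List.cons.inj h).1]; exact j.2
  · exact fun h => (cons_mem_concat ts ⟨i, h⟩ []).2 (ts _).root_mem

theorem numChildren_concat_nil {p : ℕ} (ts : Fin p → PlaneTree) :
    (concat ts).numChildren [] = p := by
  have h : ∀ i, i < (concat ts).numChildren [] ↔ i < p := fun i => by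
    rw [← (concat ts).mem_child_iff (concat ts).root_mem]
    exact singleton_mem_concat ts i
  exact le_antisymm (le_of_not_gt fun hc => lt_irrefl _ ((h p).1 hc))
    (le_of_not_gt fun hc => lt_irrefl _ ((h _).2 hc))

theorem numChildren_concat_cons {p : ℕ} (ts : Fin p → PlaneTree) (i : Fin p) (v : List ℕ) :
    (concat ts).numChildren (i :: v) = (ts i).numChildren v := by
  unfold numChildren
  congr 1
  ext j
  exact cons_mem_concat ts i (v ++ [j])

theorem concat_injective {p : ℕ} : Function.Injective (concat (p := p)) := by
  intro ts ts' h
  funext i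
  ext v
  rw [← cons_mem_concat, h, cons_mem_concat]

theorem trunc_succ_concat {p : ℕ} (ts : Fin p → PlaneTree) (R : ℕ) :
    (concat ts).trunc (R + 1) = concat (fun i => (ts i).trunc R) := by
  ext w
  constructor
  · rintro ⟨rfl | ⟨i, v, rfl, hm⟩, hl⟩
    · exact Or.inl rfl
    · exact Or.inr ⟨i, v, rfl, hm, by simpa using hl⟩
  · rintro (rfl | ⟨i, v, rfl, hm⟩)
    · exact ⟨Or.inl rfl, by simp⟩
    · exact ⟨Or.inr ⟨i, v, rfl, hm.1⟩, by simpa using hm.2⟩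

/-- The vertices of a concatenation: a new root, and the vertices of the trees. -/
def concatVert {p : ℕ} (ts : Fin p → PlaneTree) :
    Option (Σ i, (ts i).verts) → (concat ts).verts
  | none => (concat ts).root
  | some ⟨i, v⟩ => ⟨i :: v.1, Or.inr ⟨i, v.1, rfl, v.2⟩⟩

theorem concatVert_bijective {p : ℕ} (ts : Fin p → PlaneTree) :
    Function.Bijective (concatVert ts) := by
  constructor
  · rintro (_ | ⟨i, v⟩) (_ | ⟨j, w⟩) h
    · rfl
    · simpa [concatVert, root] using congrArg Subtype.val h
    · simpa [concatVert, root] using congrArg Subtype.val h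
    · obtain ⟨h1, h2⟩ := List.cons.inj (congrArg Subtype.val h)
      obtain rfl := Fin.ext h1
      obtain rfl := Subtype.ext h2
      rfl
  · rintro ⟨w, rfl | ⟨i, v, rfl, hm⟩⟩
    · exact ⟨none, rfl⟩
    · exact ⟨some ⟨i, v, hm⟩, rfl⟩

/-- The vertices of a concatenation: a new root, and the vertices of the trees. -/
def concatEquiv {p : ℕ} (ts : Fin p → PlaneTree) :
    Option (Σ i, (ts i).verts) ≃ (concat ts).verts :=
  Equiv.ofBijective _ (concatVert_bijective ts)

theorem parent_concatVert {p : ℕ} (ts : Fin p → PlaneTree) (i : Fin p) (v : (ts i).verts)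
    (hv : v ≠ (ts i).root) :
    (concat ts).parent (concatVert ts (some ⟨i, v⟩)) =
      concatVert ts (some ⟨i, (ts i).parent v⟩) := by
  refine Subtype.ext ?_
  have : v.1 ≠ [] := fun h => hv (Subtype.ext h)
  simp [parent, concatVert, List.dropLast_cons_of_ne_nil this]

theorem parent_concatVert_root {p : ℕ} (ts : Fin p → PlaneTree) (i : Fin p) :
    (concat ts).parent (concatVert ts (some ⟨i, (ts i).root⟩)) = (concat ts).root :=
  Subtype.ext rfl

/-- Concatenation respects equivalence, and the order of the trees is irrelevant. -/
theorem Equivalent.concat {p p' : ℕ} {ts : Fin p → PlaneTree} {ts' : Fin p' → PlaneTree}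
    (π : Fin p ≃ Fin p') (h : ∀ i, (ts i).Equivalent (ts' (π i))) :
    (PlaneTree.concat ts).Equivalent (PlaneTree.concat ts') := by
  choose σ h0 h1 using h
  let e : Option (Σ i, (ts i).verts) ≃ Option (Σ i, (ts' i).verts) :=
    Equiv.optionCongr (Equiv.sigmaCongr π σ)
  have he : ∀ x, ((concatEquiv ts).symm.trans (e.trans (concatEquiv ts'))) (concatVert ts x)
      = concatVert ts' (e x) := fun x => by
    have : (concatEquiv ts).symm (concatVert ts x) = x := (concatEquiv ts).symm_apply_apply x
    simp only [Equiv.trans_apply, this]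
    rfl
  generalize (concatEquiv ts).symm.trans (e.trans (concatEquiv ts')) = E at he
  refine ⟨E, he none, fun u hu => ?_⟩
  obtain ⟨x, rfl⟩ := (concatVert_bijective ts).2 u
  rw [he]
  rcases x with _ | ⟨i, v⟩
  · exact absurd rfl hu
  · have hex : ∀ v, e (some ⟨i, v⟩) = some ⟨π i, σ i v⟩ := fun _ => rfl
    by_cases hv : v = (ts i).root
    · subst hv
      rw [hex, h0, parent_concatVert_root, parent_concatVert_root]
      exact (he none).symm
    · have hv' : σ i v ≠ (ts' (π i)).root := fun hc => hv ((σ i).injective (by rw [hc, h0]))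
      rw [hex, parent_concatVert _ _ _ hv', parent_concatVert _ _ _ hv, he, hex, h1 i v hv]

theorem take_one_mem (t : PlaneTree) {u : List ℕ} (h : u ∈ t.verts) : u.take 1 ∈ t.verts :=
  t.prefix_mem (v := u.drop 1) (by rwa [List.take_append_drop])

/-- The parent of a word with at least two letters has the same first letter, so induction along
parents applies. This shows that an isomorphism sends all descendants of a child of the root below
the image of that child. -/
theorem take_one_of_iso {t t' : PlaneTree} (σ : t.verts ≃ t'.verts) (h0 : σ t.root = t'.root)
    (h1 : ∀ u : t.verts, u ≠ t.root → t'.parent (σ u) = σ (t.parent u)) (n : ℕ) :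
    ∀ u : t.verts, u.1.length = n → (σ u).1.take 1 = (σ ⟨u.1.take 1, t.take_one_mem u.2⟩).1 := by
  have hlen := length_eq_of_iso σ h0 h1
  induction n with
  | zero =>
    intro u hu
    obtain rfl : u = t.root := Subtype.ext (List.length_eq_zero_iff.1 hu)
    have h2 := congrArg Subtype.val h0
    change (σ t.root).1.take 1 = (σ t.root).1
    rw [h2]; rfl
  | succ n ih =>
    intro u hu
    have hne : u ≠ t.root := by rintro rfl; simp [root] at hu
    have hl := hlen _ u hu
    rcases Nat.eq_zero_or_pos n with rfl | hn
    · rw [List.take_of_length_le (by omega)]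
      congr 2
      exact Subtype.ext (List.take_of_length_le (by omega)).symm
    · have h2 := ih (t.parent u) (by simp [parent, hu])
      rw [← h1 u hne] at h2
      have e : ∀ l : List ℕ, 2 ≤ l.length → l.dropLast.take 1 = l.take 1 := by
        intro l hl
        rcases l with _ | ⟨a, _ | ⟨b, l⟩⟩ <;> simp at hl ⊢
      simp only [parent] at h2
      rw [e _ (by omega)] at h2
      rw [h2]
      congr 2
      exact Subtype.ext (e _ (by omega))

/-- An equivalence with a concatenation permutes the subtrees of the children of the root. -/
theorem Equivalent.exists_perm {t : PlaneTree} {p : ℕ} {ts : Fin p → PlaneTree}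
    (h : t.Equivalent (PlaneTree.concat ts)) :
    ∃ π : Fin (t.numChildren []) ≃ Fin p, ∀ i, (t.subtree i).Equivalent (ts (π i)) := by
  obtain ⟨σ, h0, h1⟩ := h
  have hlen : ∀ u : t.verts, (σ u).1.length = u.1.length :=
    fun u => length_eq_of_iso σ h0 h1 _ u rfl
  have htake : ∀ u : t.verts, (σ u).1.take 1 = (σ ⟨u.1.take 1, t.take_one_mem u.2⟩).1 :=
    fun u => take_one_of_iso σ h0 h1 _ u rfl
  have hroot : ∀ i : Fin (t.numChildren []), [(i : ℕ)] ∈ t.verts := fun i =>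
    (t.mem_child_iff t.root_mem i).2 i.2
  have hex : ∀ i : Fin (t.numChildren []), ∃ j : Fin p, (σ ⟨[(i : ℕ)], hroot i⟩).1 = [(j : ℕ)] := by
    intro i
    obtain ⟨a, ha⟩ := List.length_eq_one_iff.1 (hlen ⟨[(i : ℕ)], hroot i⟩)
    have hm := (σ ⟨[(i : ℕ)], hroot i⟩).2
    rw [ha, singleton_mem_concat] at hm
    exact ⟨⟨a, hm⟩, ha⟩
  choose π hπ using hex
  have hinj : Function.Injective π := by
    intro i j hij
    have h2 : σ ⟨[(i : ℕ)], hroot i⟩ = σ ⟨[(j : ℕ)], hroot j⟩ :=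
      Subtype.ext (by rw [hπ, hπ, hij])
    have h3 := congrArg Subtype.val (σ.injective h2)
    simpa [Fin.ext_iff] using h3
  have hsurj : Function.Surjective π := by
    intro j
    have hj := (singleton_mem_concat ts j).2 j.2
    have hl := hlen (σ.symm ⟨[(j : ℕ)], hj⟩)
    rw [Equiv.apply_symm_apply] at hl
    obtain ⟨a, ha⟩ := List.length_eq_one_iff.1 hl.symm
    have hm := (σ.symm ⟨[(j : ℕ)], hj⟩).2
    rw [ha] at hm
    refine ⟨⟨a, (t.mem_child_iff t.root_mem a).1 hm⟩, ?_⟩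
    have h2 : σ ⟨[a], hm⟩ = ⟨[(j : ℕ)], hj⟩ := by
      rw [← Equiv.eq_symm_apply]
      exact Subtype.ext ha.symm
    have h3 := hπ ⟨a, (t.mem_child_iff t.root_mem a).1 hm⟩
    rw [h2] at h3
    exact Fin.ext (List.cons.inj h3).1.symm
  refine ⟨Equiv.ofBijective π ⟨hinj, hsurj⟩, fun i => ?_⟩
  change (t.subtree i).Equivalent (ts (π i))
  have hsh : ∀ v : (t.subtree i).verts, ∃ w : (ts (π i)).verts,
      (σ ⟨(i : ℕ) :: v.1, v.2⟩).1 = (π i : ℕ) :: w.1 := by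
    intro v
    have h2 := htake ⟨(i : ℕ) :: v.1, v.2⟩
    have h3 : (σ ⟨((i : ℕ) :: v.1).take 1, t.take_one_mem v.2⟩).1 = [(π i : ℕ)] := hπ i
    rw [h3] at h2
    have hl := hlen ⟨(i : ℕ) :: v.1, v.2⟩
    have hm := (σ ⟨(i : ℕ) :: v.1, v.2⟩).2
    generalize (σ ⟨(i : ℕ) :: v.1, v.2⟩).1 = l at h2 hl hm
    rcases l with _ | ⟨a, l⟩
    · simp at hl
    · simp only [List.take_succ_cons, List.take_zero, List.cons.injEq, and_true] at h2
      subst h2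
      exact ⟨⟨l, (cons_mem_concat ts (π i) l).1 hm⟩, rfl⟩
  choose τ hτ using hsh
  have hτinj : Function.Injective τ := by
    intro v w hvw
    have h2 : σ ⟨(i : ℕ) :: v.1, v.2⟩ = σ ⟨(i : ℕ) :: w.1, w.2⟩ :=
      Subtype.ext (by rw [hτ, hτ, hvw])
    exact Subtype.ext (List.cons.inj (congrArg Subtype.val (σ.injective h2))).2
  have hτsurj : Function.Surjective τ := by
    intro w
    have hw : (π i : ℕ) :: w.1 ∈ (PlaneTree.concat ts).verts := (cons_mem_concat ts _ _).2 w.2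
    obtain ⟨⟨l, hl⟩, hu⟩ := σ.surjective ⟨_, hw⟩
    have h2 := htake ⟨l, hl⟩
    have h3 := hlen ⟨l, hl⟩
    rw [hu] at h2 h3
    rcases l with _ | ⟨a, l⟩
    · simp at h3
    · have ha : [a] ∈ t.verts := t.take_one_mem hl
      have hai : a < t.numChildren [] := (t.mem_child_iff t.root_mem a).1 ha
      have h4 : (σ ⟨[a], ha⟩).1 = [(π i : ℕ)] := h2.symm
      have h5 := hπ ⟨a, hai⟩
      have h6 : [(π i : ℕ)] = [(π ⟨a, hai⟩ : ℕ)] := h4.symm.trans h5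
      have h7 : i = ⟨a, hai⟩ := hinj (Fin.ext (List.cons.inj h6).1)
      subst h7
      refine ⟨⟨l, hl⟩, Subtype.ext ?_⟩
      have h8 := hτ ⟨l, hl⟩
      have h9 := congrArg Subtype.val hu
      simp only at h9
      rw [h9] at h8
      exact (List.cons.inj h8).2.symm
  refine ⟨Equiv.ofBijective τ ⟨hτinj, hτsurj⟩, ?_, fun u hu => ?_⟩
  · refine Subtype.ext ?_
    have h2 := hτ (t.subtree i).root
    rw [show (σ ⟨(i : ℕ) :: (t.subtree i).root.1, (t.subtree i).root.2⟩).1 = [(π i : ℕ)] from hπ i]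
      at h2
    exact (List.cons.inj h2).2.symm
  · refine Subtype.ext ?_
    change (τ u).1.dropLast = (τ ((t.subtree i).parent u)).1
    have hu' : u.1 ≠ [] := fun h => hu (Subtype.ext h)
    have h2 := hτ u
    have h3 := hτ ((t.subtree i).parent u)
    have h4 := congrArg Subtype.val (h1 ⟨(i : ℕ) :: u.1, u.2⟩
      (fun hc => by simpa [root] using congrArg Subtype.val hc))
    have h5 : t.parent ⟨(i : ℕ) :: u.1, u.2⟩ = ⟨(i : ℕ) :: ((t.subtree i).parent u).1,
        ((t.subtree i).parent u).2⟩ :=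
      Subtype.ext (List.dropLast_cons_of_ne_nil hu')
    rw [h5, h3] at h4
    simp only [parent] at h4
    rw [h2] at h4
    have h6 : (τ u).1 ≠ [] := by
      have h7 := hlen ⟨(i : ℕ) :: u.1, u.2⟩
      rw [h2] at h7
      intro hc
      rw [hc] at h7
      simp only [List.length_cons, List.length_nil] at h7
      exact hu' (List.length_eq_zero_iff.1 (by omega))
    rw [List.dropLast_cons_of_ne_nil h6] at h4
    exact (List.cons.inj h4).2

/-- The number of vertices with out-degree in `A`. -/
def degCount (A : Set ℕ) (t : PlaneTree) : ℕ := Nat.card {u : t.verts // t.numChildren u.1 ∈ A}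

/-- The right side involves only the root and the parent map, hence is visibly preserved by
equivalences. -/
theorem numChildren_eq_card (t : PlaneTree) (u : t.verts) :
    t.numChildren u.1 = Nat.card {v : t.verts // v ≠ t.root ∧ t.parent v = u} := by
  rw [numChildren, ← Nat.card_coe_set_eq]
  refine Nat.card_congr (Equiv.ofBijective (fun i => ⟨⟨u.1 ++ [i.1], i.2⟩, fun hc => ?_, ?_⟩)
    ⟨?_, ?_⟩)
  · simpa [root] using congrArg Subtype.val hc
  · exact Subtype.ext (by simp [parent])
  · intro i j hij
    have := congrArg (fun x => x.1.1) hij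
    exact Subtype.ext (by simpa using this)
  · rintro ⟨⟨v, hv⟩, hne, hp⟩
    have hv' : v ≠ [] := fun h => hne (Subtype.ext h)
    have hp' : v.dropLast = u.1 := congrArg Subtype.val hp
    refine ⟨⟨v.getLast hv', ?_⟩, ?_⟩
    · change u.1 ++ [v.getLast hv'] ∈ t.verts
      rw [← hp', List.dropLast_append_getLast hv']; exact hv
    · refine Subtype.ext (Subtype.ext ?_)
      change u.1 ++ [v.getLast hv'] = v
      rw [← hp', List.dropLast_append_getLast hv']

theorem numChildren_iso {t t' : PlaneTree} (σ : t.verts ≃ t'.verts) (h0 : σ t.root = t'.root)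
    (h1 : ∀ u : t.verts, u ≠ t.root → t'.parent (σ u) = σ (t.parent u)) (u : t.verts) :
    t'.numChildren (σ u).1 = t.numChildren u.1 := by
  rw [numChildren_eq_card, numChildren_eq_card]
  refine (Nat.card_congr (Equiv.subtypeEquiv σ fun v => ?_)).symm
  have hne : σ v ≠ t'.root ↔ v ≠ t.root := by rw [← h0, σ.injective.ne_iff]
  rw [hne]
  refine and_congr_right fun hv => ?_
  rw [h1 v hv, σ.injective.eq_iff]

theorem Equivalent.degCount_eq {t t' : PlaneTree} (h : t.Equivalent t') (A : Set ℕ) :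
    t.degCount A = t'.degCount A := by
  obtain ⟨σ, h0, h1⟩ := h
  exact Nat.card_congr (Equiv.subtypeEquiv σ fun u => by rw [numChildren_iso σ h0 h1])

theorem Equivalent.finite_iff {t t' : PlaneTree} (h : t.Equivalent t') :
    t.verts.Finite ↔ t'.verts.Finite := by
  obtain ⟨σ, -, -⟩ := h
  exact σ.finite_iff

theorem degCount_univ (t : PlaneTree) : t.degCount Set.univ = t.verts.ncard := by
  rw [degCount, ← Nat.card_coe_set_eq]
  exact Nat.card_congr (Equiv.subtypeUnivEquiv fun _ => Set.mem_univ _)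

theorem degCount_zero (t : PlaneTree) : t.degCount {0} = t.leaves.ncard := by
  rw [degCount, ← Nat.card_coe_set_eq]
  exact Nat.card_congr (Equiv.subtypeSubtypeEquivSubtypeInter (· ∈ t.verts)
    fun u => t.numChildren u = 0)

end PlaneTree

/-! ### Finite plane trees, their weights and counts -/

/-- Finite plane trees. -/
abbrev FinTree : Type := {t : PlaneTree // t.verts.Finite}

namespace FinTree

instance : Countable FinTree := by
  have : Function.Injective (fun t : FinTree => t.2.toFinset) := by
    intro t t' h
    refine Subtype.ext (PlaneTree.ext ?_)
    simpa using h
  exact this.countable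

theorem finite_concat {p : ℕ} (ts : Fin p → FinTree) :
    (PlaneTree.concat fun i => (ts i).1).verts.Finite := by
  have : ∀ i, Finite (ts i).1.verts := fun i => (ts i).2
  exact (PlaneTree.concatEquiv fun i => (ts i).1).finite_iff.1 inferInstance

/-- Concatenation of finite trees. -/
def concat {p : ℕ} (ts : Fin p → FinTree) : FinTree := ⟨_, finite_concat ts⟩

theorem finite_subtree (t : FinTree) (i : Fin (t.1.numChildren [])) :
    (t.1.subtree i).verts.Finite :=
  t.2.preimage (f := fun v => (i : ℕ) :: v) fun _ _ _ _ h => (List.cons.inj h).2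

theorem concat_bijective :
    Function.Bijective (fun x : Σ k, Fin k → FinTree => concat x.2) := by
  constructor
  · rintro ⟨k, ts⟩ ⟨k', ts'⟩ h
    have h1 : PlaneTree.concat (fun i => (ts i).1) = PlaneTree.concat (fun i => (ts' i).1) :=
      congrArg Subtype.val h
    obtain rfl : k = k' := by
      rw [← PlaneTree.numChildren_concat_nil (fun i => (ts i).1), h1,
        PlaneTree.numChildren_concat_nil]
    have h2 := PlaneTree.concat_injective h1
    congr 1
    funext i
    exact Subtype.ext (congrFun h2 i)
  · intro t
    exact ⟨⟨_, fun i => ⟨t.1.subtree i, finite_subtree t i⟩⟩,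
      Subtype.ext (PlaneTree.concat_subtree t.1)⟩

theorem exists_concat (t : FinTree) : ∃ (k : ℕ) (ts : Fin k → FinTree), t = concat ts := by
  obtain ⟨⟨k, ts⟩, h⟩ := concat_bijective.2 t
  exact ⟨k, ts, h.symm⟩

/-- Decomposition of a sum over finite trees according to the children of the root. -/
theorem tsum_eq (g : FinTree → ℝ≥0∞) :
    ∑' t, g t = ∑' k : ℕ, ∑' ts : Fin k → FinTree, g (concat ts) := by
  rw [← (Equiv.ofBijective _ concat_bijective).tsum_eq]
  exact ENNReal.tsum_sigma fun k (ts : Fin k → FinTree) => g (concat ts)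

/-- The Galton-Watson weight of a finite plane tree. -/
def weight (ξ : PMF ℕ) (t : FinTree) : ℝ≥0∞ := ∏ u ∈ t.2.toFinset, ξ (t.1.numChildren u)

theorem prod_verts {M : Type*} [CommMonoid M] {t : PlaneTree} (h : t.verts.Finite)
    [Fintype t.verts] (g : List ℕ → M) : ∏ u ∈ h.toFinset, g u = ∏ u : t.verts, g u :=
  Finset.prod_subtype _ (fun _ => h.mem_toFinset) g

/-- A general commutative monoid serves both the weights and, through `Multiplicative ℕ`, the
additive counts. -/
theorem prod_concat {M : Type*} [CommMonoid M] {p : ℕ} (ts : Fin p → FinTree) (g : ℕ → M) :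
    ∏ u ∈ (finite_concat ts).toFinset,
        g ((PlaneTree.concat fun i => (ts i).1).numChildren u)
      = g p * ∏ i, ∏ u ∈ (ts i).2.toFinset, g ((ts i).1.numChildren u) := by
  have : ∀ i, Fintype (ts i).1.verts := fun i => (ts i).2.fintype
  have : Fintype (PlaneTree.concat fun i => (ts i).1).verts := (finite_concat ts).fintype
  rw [prod_verts (finite_concat ts) fun u => g ((PlaneTree.concat fun i => (ts i).1).numChildren u),
    ← (PlaneTree.concatEquiv fun i => (ts i).1).prod_comp, Fintype.prod_option, Fintype.prod_sigma]
  congr 1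
  · change g ((PlaneTree.concat fun i => (ts i).1).numChildren []) = g p
    rw [PlaneTree.numChildren_concat_nil]
  · refine Finset.prod_congr rfl fun i _ => ?_
    rw [prod_verts (ts i).2 fun u => g ((ts i).1.numChildren u)]
    refine Finset.prod_congr rfl fun v _ => ?_
    exact congrArg g (PlaneTree.numChildren_concat_cons (fun i => (ts i).1) i v)

theorem weight_concat (ξ : PMF ℕ) {p : ℕ} (ts : Fin p → FinTree) :
    weight ξ (concat ts) = ξ p * ∏ i, weight ξ (ts i) := prod_concat ts ξ

/-- The number of vertices with out-degree in `A`. -/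
def count (A : Set ℕ) (t : FinTree) : ℕ := t.1.degCount A

theorem count_eq_sum (A : Set ℕ) (t : FinTree) :
    count A t = ∑ u ∈ t.2.toFinset, A.indicator (fun _ => 1) (t.1.numChildren u) := by
  classical
  have : Fintype t.1.verts := t.2.fintype
  have h := prod_verts (M := Multiplicative ℕ) t.2
    fun u => Multiplicative.ofAdd (A.indicator (fun _ => 1) (t.1.numChildren u))
  have h2 : ∑ u ∈ t.2.toFinset, A.indicator (fun _ => 1) (t.1.numChildren u)
      = ∑ u : t.1.verts, A.indicator (fun _ => 1) (t.1.numChildren u) := h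
  rw [h2, count, PlaneTree.degCount, Nat.card_eq_fintype_card, Fintype.card_subtype,
    Finset.card_eq_sum_ones, Finset.sum_filter]
  rfl

theorem count_concat (A : Set ℕ) {p : ℕ} (ts : Fin p → FinTree) :
    count A (concat ts) = A.indicator (fun _ => 1) p + ∑ i, count A (ts i) := by
  simp_rw [count_eq_sum]
  exact prod_concat (M := Multiplicative ℕ) ts
    fun k => Multiplicative.ofAdd (A.indicator (fun _ => 1) k)

theorem induction {P : FinTree → Prop} (h : ∀ (k : ℕ) (ts : Fin k → FinTree),
    (∀ i, P (ts i)) → P (concat ts)) (t : FinTree) : P t := by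
  induction hn : count Set.univ t using Nat.strong_induction_on generalizing t with
  | _ n ih =>
  obtain ⟨k, ts, rfl⟩ := exists_concat t
  refine h k ts fun i => ih _ ?_ (ts i) rfl
  rw [← hn, count_concat]
  have := Finset.single_le_sum (f := fun i => count Set.univ (ts i)) (fun _ _ => Nat.zero_le _)
    (Finset.mem_univ i)
  simp only [Set.indicator_univ]
  omega

theorem count_pos {A : Set ℕ} (hA : 0 ∈ A) (t : FinTree) : 1 ≤ count A t := by
  induction t using FinTree.induction with
  | h k ts ih =>
  rw [count_concat]
  rcases k with _ | k
  · simp [hA]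
  · have := Finset.single_le_sum (f := fun i => count A (ts i)) (fun _ _ => Nat.zero_le _)
      (Finset.mem_univ 0)
    have := ih 0
    omega

end FinTree

/-! ### The local topology on unordered trees -/

namespace UTree

theorem mk_out (τ : UTree) : mk τ.out = τ := Quotient.out_eq τ

theorem mk_surjective : Function.Surjective mk := fun τ => ⟨τ.out, mk_out τ⟩

theorem trunc_mk (R : ℕ) (t : PlaneTree) : (mk t).trunc R = mk (t.trunc R) := rfl

theorem concat_mk {p : ℕ} (ts : Fin p → PlaneTree) :
    concat (fun i => mk (ts i)) = mk (PlaneTree.concat ts) :=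
  PlaneTree.mk_eq_mk_iff.2 (PlaneTree.Equivalent.concat (Equiv.refl _) fun _ =>
    PlaneTree.mk_eq_mk_iff.1 (mk_out _))

theorem concat_perm {p p' : ℕ} (π : Fin p ≃ Fin p') (τ : Fin p' → UTree) :
    concat (fun i => τ (π i)) = concat τ :=
  PlaneTree.mk_eq_mk_iff.2 (PlaneTree.Equivalent.concat π fun _ => PlaneTree.Equivalent.refl _)

theorem trunc_trunc (τ : UTree) (R S : ℕ) : (τ.trunc R).trunc S = τ.trunc (min R S) := by
  obtain ⟨t, rfl⟩ := mk_surjective τ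
  rw [trunc_mk, trunc_mk, trunc_mk, PlaneTree.trunc_trunc]

theorem trunc_eq_of_le {τ σ : UTree} {R S : ℕ} (h : τ.trunc R = σ.trunc R) (hS : S ≤ R) :
    τ.trunc S = σ.trunc S := by
  rw [← min_eq_right hS, ← trunc_trunc, h, trunc_trunc]

theorem trunc_zero (τ σ : UTree) : τ.trunc 0 = σ.trunc 0 := by
  obtain ⟨t, rfl⟩ := mk_surjective τ
  obtain ⟨s, rfl⟩ := mk_surjective σ
  rw [trunc_mk, trunc_mk]
  congr 1
  ext u
  change u ∈ t.verts ∧ u.length ≤ 0 ↔ u ∈ s.verts ∧ u.length ≤ 0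
  simp only [Nat.le_zero, List.length_eq_zero_iff]
  constructor <;> rintro ⟨-, rfl⟩
  exacts [⟨s.root_mem, rfl⟩, ⟨t.root_mem, rfl⟩]

theorem trunc_succ_concat {p : ℕ} (τ : Fin p → UTree) (R : ℕ) :
    (concat τ).trunc (R + 1) = concat (fun i => (τ i).trunc R) := by
  choose t ht using fun i => mk_surjective (τ i)
  obtain rfl : (fun i => mk (t i)) = τ := funext ht
  simp_rw [concat_mk, trunc_mk, PlaneTree.trunc_succ_concat, concat_mk]

theorem trunc_succ_concat_congr {p : ℕ} {τ σ : Fin p → UTree} {R : ℕ}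
    (h : ∀ i, (τ i).trunc R = (σ i).trunc R) :
    (concat τ).trunc (R + 1) = (concat σ).trunc (R + 1) := by
  rw [trunc_succ_concat, trunc_succ_concat]
  simp_rw [h]

theorem eventually_trunc_eq (τ : UTree) (R : ℕ) : ∀ᶠ σ in 𝓝 τ, σ.trunc R = τ.trunc R := by
  filter_upwards [Metric.ball_mem_nhds τ (Real.exp_pos (-(R : ℝ)))] with σ hσ
  by_contra hne
  exact absurd (exp_le_locDist hne) (not_le.2 hσ)

theorem exists_trunc_mem {τ : UTree} {U : Set UTree} (hU : U ∈ 𝓝 τ) :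
    ∃ R : ℕ, ∀ σ : UTree, σ.trunc R = τ.trunc R → σ ∈ U := by
  obtain ⟨ε, hε, hb⟩ := Metric.mem_nhds_iff.1 hU
  obtain ⟨R, hR⟩ : ∃ R : ℕ, Real.exp (-(R : ℝ)) < ε := by
    have : Tendsto (fun R : ℕ => Real.exp (-(R : ℝ))) atTop (𝓝 0) :=
      Real.tendsto_exp_neg_atTop_nhds_zero.comp tendsto_natCast_atTop_atTop
    exact (this.eventually (gt_mem_nhds hε)).exists
  refine ⟨R, fun σ hσ => hb ?_⟩
  change locDist σ τ < ε
  refine lt_of_le_of_lt ?_ hR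
  unfold locDist
  split_ifs with h
  · exact (Real.exp_pos _).le
  · push Not at h
    have hm : σ.trunc (sInf {R : ℕ | σ.trunc R ≠ τ.trunc R}) ≠ _ := Nat.sInf_mem h
    have : R ≤ sInf {R : ℕ | σ.trunc R ≠ τ.trunc R} := by
      by_contra hc
      exact hm (trunc_eq_of_le hσ (by omega))
    gcongr

/-- The function `φ` depends only on the ball of radius `R`. -/
def DependsOnBall {α : Type*} (R : ℕ) (φ : UTree → α) : Prop :=
  ∀ τ σ : UTree, τ.trunc R = σ.trunc R → φ τ = φ σ

theorem DependsOnBall.continuous {α : Type*} [TopologicalSpace α] {R : ℕ} {φ : UTree → α}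
    (h : DependsOnBall R φ) : Continuous φ := by
  refine continuous_iff_continuousAt.2 fun τ => ?_
  have : φ =ᶠ[𝓝 τ] fun _ => φ τ := by
    filter_upwards [eventually_trunc_eq τ R] with σ hσ using h _ _ hσ
  exact (continuousAt_const.congr this.symm)

theorem finite_trunc (t : PlaneTree) (R : ℕ) : (t.trunc R).verts.Finite := by
  induction R generalizing t with
  | zero =>
    refine (Set.finite_singleton []).subset fun u hu => ?_
    exact List.length_eq_zero_iff.1 (Nat.le_zero.1 hu.2)
  | succ R ih =>
    rw [← PlaneTree.concat_subtree t, PlaneTree.trunc_succ_concat]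
    exact FinTree.finite_concat fun i => ⟨_, ih (t.subtree i)⟩

/-- Balls are finite trees, of which there are countably many, and they are dense. Second
countability makes product and Borel σ-algebras agree on countable products, so that continuous
constructions of trees are measurable. -/
instance : SecondCountableTopology UTree := by
  have : TopologicalSpace.SeparableSpace UTree := by
    refine ⟨Set.range (fun t : FinTree => mk t.1), Set.countable_range _, fun τ => ?_⟩
    refine mem_closure_iff_nhds.2 fun U hU => ?_
    obtain ⟨R, hR⟩ := exists_trunc_mem hU
    obtain ⟨t, rfl⟩ := mk_surjective τ
    refine ⟨mk (t.trunc R), hR _ ?_, ⟨⟨t.trunc R, finite_trunc t R⟩, rfl⟩⟩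
    rw [trunc_mk, trunc_mk, PlaneTree.trunc_trunc, min_self]
  exact UniformSpace.secondCountable_of_separable UTree

/-- A finite tree is an isolated point. -/
theorem singleton_mem_nhds {t : PlaneTree} (ht : t.verts.Finite) : {mk t} ∈ 𝓝 (mk t) := by
  obtain ⟨R, hR⟩ : ∃ R : ℕ, ∀ u ∈ t.verts, u.length ≤ R := by
    obtain ⟨R, hR⟩ := (ht.image List.length).bddAbove
    exact ⟨R, fun u hu => hR ⟨u, hu, rfl⟩⟩
  -- The radius exceeds the height bound by one: a tree with the same ball has no vertex at height
  -- `R + 1`, hence none beyond.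
  filter_upwards [eventually_trunc_eq (mk t) (R + 1)] with σ hσ
  obtain ⟨s, rfl⟩ := mk_surjective σ
  have e1 : t.trunc (R + 1) = t := by
    ext u
    exact ⟨fun h => h.1, fun h => ⟨h, (hR u h).trans (Nat.le_succ R)⟩⟩
  rw [trunc_mk, trunc_mk, e1] at hσ
  have hσ' := PlaneTree.mk_eq_mk_iff.1 hσ
  obtain ⟨σ, h0, h1⟩ := hσ'
  have hlen : ∀ u ∈ s.verts, u.length ≤ R + 1 → u.length ≤ R := fun u hu hl => by
    have h2 := PlaneTree.length_eq_of_iso σ h0 h1 _ ⟨u, hu, hl⟩ rfl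
    rw [← show _ = u.length from h2]
    exact hR _ (σ _).2
  have hall : ∀ n, ∀ u ∈ s.verts, u.length = n → n ≤ R := by
    intro n
    induction n with
    | zero => intro _ _ _; exact Nat.zero_le R
    | succ n ih =>
      intro u hu hl
      have h2 := ih _ (s.dropLast_mem hu) (by simp [hl])
      have h3 := hlen u hu (by omega)
      omega
  have e2 : s.trunc (R + 1) = s := by
    ext u
    exact ⟨fun h => h.1, fun h => ⟨h, (hall _ u h rfl).trans (Nat.le_succ R)⟩⟩
  rw [e2] at hσ
  exact hσ

/-- Any set of finite trees is open. -/
theorem isOpen_of_finite {B : Set UTree} (h : ∀ τ ∈ B, ∃ t : PlaneTree, mk t = τ ∧ t.verts.Finite) :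
    IsOpen B := by
  refine isOpen_iff_mem_nhds.2 fun τ hτ => ?_
  obtain ⟨t, rfl, ht⟩ := h τ hτ
  exact mem_of_superset (singleton_mem_nhds ht) (by simpa using hτ)

/-- The set of finite trees with `n` vertices having out-degree in `A`. -/
def withCount (A : Set ℕ) (n : ℕ) : Set UTree :=
  {τ | ∃ t : PlaneTree, mk t = τ ∧ t.verts.Finite ∧ t.degCount A = n}

theorem withVertices_eq (n : ℕ) : withVertices n = withCount Set.univ n := by
  simp only [withVertices, withCount, PlaneTree.degCount_univ]

theorem withLeaves_eq (n : ℕ) : withLeaves n = withCount {0} n := by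
  simp only [withLeaves, withCount, PlaneTree.degCount_zero]

theorem measurableSet_withCount (A : Set ℕ) (n : ℕ) : MeasurableSet (withCount A n) :=
  (isOpen_of_finite fun _ hτ => by
    obtain ⟨t, h1, h2, -⟩ := hτ
    exact ⟨t, h1, h2⟩).measurableSet

theorem mk_mem_withCount (A : Set ℕ) (n : ℕ) (t : FinTree) :
    mk t.1 ∈ withCount A n ↔ t.count A = n := by
  constructor
  · rintro ⟨s, hs, -, hn⟩
    rw [← hn]
    exact ((PlaneTree.mk_eq_mk_iff.1 hs).degCount_eq A).symm
  · exact fun h => ⟨t.1, rfl, t.2, h⟩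

end UTree

/-! ### Critical Galton–Watson weights and their generating series -/

theorem tsum_fin_succ {α : Type*} {k : ℕ} (g : (Fin (k + 1) → α) → ℝ≥0∞) :
    ∑' ts, g ts = ∑' (t : α) (ts : Fin k → α), g (Fin.cons t ts) := by
  rw [← (Fin.consEquiv fun _ : Fin (k + 1) => α).tsum_eq]
  exact ENNReal.tsum_prod (f := fun t (ts : Fin k → α) => g (Fin.cons t ts))

theorem tsum_prod_eq_pow {α : Type*} (g : α → ℝ≥0∞) (k : ℕ) :
    ∑' ts : Fin k → α, ∏ i, g (ts i) = (∑' t, g t) ^ k := by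
  induction k with
  | zero => simp
  | succ k ih =>
    rw [tsum_fin_succ, pow_succ', ← ih, ← ENNReal.tsum_mul_right]
    simp_rw [Fin.prod_univ_succ, Fin.cons_zero, Fin.cons_succ, ENNReal.tsum_mul_left]

section Offspring

variable {ξ : PMF ℕ}

theorem exists_two_le (hmean : ∑' k : ℕ, (k : ℝ≥0∞) * ξ k = 1) (hξ : ξ 1 < 1) :
    ∃ k, 2 ≤ k ∧ ξ k ≠ 0 := by
  by_contra! h
  rw [tsum_eq_single 1] at hmean
  · simp at hmean
    exact hξ.ne hmean
  · rintro (_ | _ | k) hk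
    · simp
    · simp at hk
    · rw [h _ (by omega), mul_zero]

/-- Otherwise `k ξ k ≥ ξ k` for all `k`, strictly for some `k ≥ 2`, and the mean would exceed 1. -/
theorem offspring_zero_ne_zero (hmean : ∑' k : ℕ, (k : ℝ≥0∞) * ξ k = 1) (hξ : ξ 1 < 1) :
    ξ 0 ≠ 0 := by
  intro h0
  obtain ⟨k, hk, hk0⟩ := exists_two_le hmean hξ
  have h1 : ∑' k, ξ k < ∑' k : ℕ, (k : ℝ≥0∞) * ξ k := by
    refine ENNReal.tsum_lt_tsum (by rw [ξ.tsum_coe]; exact ENNReal.one_ne_top) (fun j => ?_)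
      (i := k) ?_
    · rcases j with _ | j
      · simp [h0]
      · exact le_mul_of_one_le_left (zero_le) (by norm_cast; omega)
    · have h2 : (1 : ℝ≥0∞) < k := by exact_mod_cast hk
      calc ξ k = 1 * ξ k := (one_mul _).symm
        _ < k * ξ k := ENNReal.mul_lt_mul_left hk0 (ξ.apply_ne_top k) h2
  rw [ξ.tsum_coe, hmean] at h1
  exact lt_irrefl _ h1

end Offspring

namespace FinTree

variable {ξ : PMF ℕ}

theorem tsum_weight_mul (g : FinTree → ℝ≥0∞) :
    ∑' t, weight ξ t * g t = ∑' k : ℕ, ξ k * ∑' ts : Fin k → FinTree,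
      (∏ i, weight ξ (ts i)) * g (concat ts) := by
  rw [tsum_eq]
  simp_rw [weight_concat, mul_assoc, ENNReal.tsum_mul_left]

/-- The mass `q N` of the trees with at most `N` vertices satisfies `q (N + 1) ≤ ∑ ξ k (q N) ^ k`,
so it stays below 1. -/
theorem tsum_weight_le_one : ∑' t, weight ξ t ≤ 1 := by
  have hN : ∀ N : ℕ, ∑' t, weight ξ t * (if count Set.univ t ≤ N then 1 else 0) ≤ 1 := by
    intro N
    induction N with
    | zero =>
      refine (ENNReal.tsum_eq_zero.2 fun t => ?_).trans_le zero_le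
      have := count_pos (Set.mem_univ 0) t
      rw [if_neg (by omega), mul_zero]
    | succ N ih =>
      rw [tsum_weight_mul]
      calc _ ≤ ∑' k, ξ k * (∑' t, weight ξ t * (if count Set.univ t ≤ N then 1 else 0)) ^ k := by
            refine ENNReal.tsum_le_tsum fun k => mul_le_mul_right ?_ _
            rw [← tsum_prod_eq_pow]
            refine ENNReal.tsum_le_tsum fun ts => ?_
            rw [Finset.prod_mul_distrib]
            refine mul_le_mul_right ?_ _
            split_ifs with h
            · rw [Finset.prod_eq_one]
              intro i _
              rw [count_concat] at h
              have := Finset.single_le_sum (f := fun i => count Set.univ (ts i))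
                (fun _ _ => Nat.zero_le _) (Finset.mem_univ i)
              simp only [Set.indicator_univ] at h
              rw [if_pos (by omega)]
            · exact zero_le
        _ ≤ ∑' k, ξ k := ENNReal.tsum_le_tsum fun k =>
            mul_le_of_le_one_right zero_le (pow_le_one₀ zero_le ih)
        _ = 1 := ξ.tsum_coe
  rw [ENNReal.tsum_eq_iSup_sum]
  refine iSup_le fun S => ?_
  refine le_trans ?_ (hN (S.sup (count Set.univ)))
  refine le_trans (le_of_eq ?_) (ENNReal.sum_le_tsum S)
  refine Finset.sum_congr rfl fun t ht => ?_
  rw [if_pos (Finset.le_sup ht), mul_one]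

theorem pow_add_mul_one_sub {p : ℝ≥0∞} (hp : p < 1) (k : ℕ) :
    1 ≤ p ^ k + k * (1 - p) ∧ (2 ≤ k → 1 < p ^ k + k * (1 - p)) := by
  lift p to NNReal using hp.ne_top
  have hp' : (p : ℝ) < 1 := by exact_mod_cast hp
  have hp1 : p ≤ 1 := le_of_lt (by exact_mod_cast hp)
  have hb : ∀ j : ℕ, 1 - (j : ℝ) * (1 - p) ≤ (p : ℝ) ^ j := fun j => by
    have := one_add_mul_le_pow (a := (p : ℝ) - 1) (by have := p.2; change (0:ℝ) ≤ p at this; linarith) j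
    rw [add_sub_cancel] at this
    linarith
  have e : (p : ℝ≥0∞) ^ k + k * (1 - p) = ((p ^ k + k * (1 - p) : NNReal) : ℝ≥0∞) := by
    push_cast; rfl
  rw [e]
  constructor
  · rw [ENNReal.one_le_coe_iff, ← NNReal.coe_le_coe]
    push_cast [NNReal.coe_sub hp1]
    linarith [hb k]
  · intro hk
    rw [ENNReal.one_lt_coe_iff, ← NNReal.coe_lt_coe]
    push_cast [NNReal.coe_sub hp1]
    obtain ⟨j, rfl⟩ : ∃ j, k = j + 1 := ⟨k - 1, by omega⟩
    have h1 := hb j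
    have h2 : (1 : ℝ) ≤ j := by exact_mod_cast (by omega : 1 ≤ j)
    have h3 : (0 : ℝ) ≤ p := p.2
    rw [pow_succ]
    push_cast
    have h4 := mul_le_mul_of_nonneg_right h1 h3
    have h5 : 0 < (1 - (p : ℝ)) * (1 - p) := by nlinarith
    nlinarith

/-- Almost sure extinction. The mass `p` is a fixed point of the offspring generating function,
whose tangent at 1 is the diagonal because the mean is 1; strict convexity (Bernoulli's inequality,
strict for some `k ≥ 2`) excludes fixed points below 1. -/
theorem tsum_weight (hmean : ∑' k : ℕ, (k : ℝ≥0∞) * ξ k = 1) (hξ : ξ 1 < 1) :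
    ∑' t, weight ξ t = 1 := by
  set p := ∑' t, weight ξ t with hp
  by_contra hne
  have hlt : p < 1 := lt_of_le_of_ne tsum_weight_le_one hne
  have hfix : p = ∑' k, ξ k * p ^ k := by
    have := tsum_weight_mul (ξ := ξ) fun _ => 1
    simp only [mul_one, tsum_prod_eq_pow] at this
    exact this
  obtain ⟨k, hk, hk0⟩ := exists_two_le hmean hξ
  have h1 : ∑' k, ξ k < ∑' k : ℕ, ξ k * (p ^ k + k * (1 - p)) := by
    refine ENNReal.tsum_lt_tsum (by rw [ξ.tsum_coe]; exact ENNReal.one_ne_top) (fun j => ?_)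
      (i := k) ?_
    · exact le_mul_of_one_le_right zero_le (pow_add_mul_one_sub hlt j).1
    · calc ξ k = ξ k * 1 := (mul_one _).symm
        _ < _ := ENNReal.mul_lt_mul_right hk0 (ξ.apply_ne_top k)
            ((pow_add_mul_one_sub hlt k).2 hk)
  have h2 : ∑' k : ℕ, ξ k * (p ^ k + k * (1 - p)) = p + (1 - p) := by
    simp_rw [mul_add]
    rw [ENNReal.tsum_add, ← hfix]
    congr 1
    have : ∀ k : ℕ, ξ k * (k * (1 - p)) = (k * ξ k) * (1 - p) := fun k => by ring
    simp_rw [this]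
    rw [ENNReal.tsum_mul_right, hmean, one_mul]
  rw [h2, ξ.tsum_coe, add_tsub_cancel_of_le hlt.le] at h1
  exact lt_irrefl _ h1

/-- The total weight of the forests of `k` trees with `n` vertices having out-degree in `A`. -/
def forestMass (ξ : PMF ℕ) (A : Set ℕ) (k n : ℕ) : ℝ≥0∞ :=
  ∑' ts : Fin k → FinTree, (∏ i, weight ξ (ts i)) * (if ∑ i, count A (ts i) = n then 1 else 0)

/-- The total weight of the finite trees with `n` vertices having out-degree in `A`. -/
def treeMass (ξ : PMF ℕ) (A : Set ℕ) (n : ℕ) : ℝ≥0∞ :=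
  ∑' t, weight ξ t * (if count A t = n then 1 else 0)

theorem treeMass_le_one (A : Set ℕ) (n : ℕ) : treeMass ξ A n ≤ 1 :=
  (ENNReal.tsum_le_tsum fun t => mul_le_of_le_one_right zero_le (by split_ifs <;> simp)).trans
    tsum_weight_le_one

theorem treeMass_ne_top (A : Set ℕ) (n : ℕ) : treeMass ξ A n ≠ ∞ :=
  ((treeMass_le_one A n).trans_lt ENNReal.one_lt_top).ne

theorem treeMass_zero {A : Set ℕ} (hA : 0 ∈ A) : treeMass ξ A 0 = 0 :=
  ENNReal.tsum_eq_zero.2 fun t => by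
    have := count_pos hA t
    rw [if_neg (by omega), mul_zero]

theorem forestMass_ne_top (A : Set ℕ) (k n : ℕ) : forestMass ξ A k n ≠ ∞ := by
  refine (lt_of_le_of_lt (?_ : _ ≤ (1 : ℝ≥0∞)) ENNReal.one_lt_top).ne
  calc forestMass ξ A k n ≤ ∑' ts : Fin k → FinTree, ∏ i, weight ξ (ts i) :=
        ENNReal.tsum_le_tsum fun t => mul_le_of_le_one_right zero_le (by split_ifs <;> simp)
    _ = (∑' t, weight ξ t) ^ k := tsum_prod_eq_pow _ k
    _ ≤ 1 := pow_le_one₀ zero_le tsum_weight_le_one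

theorem forestMass_succ (A : Set ℕ) (k n : ℕ) : forestMass ξ A (k + 1) n
    = ∑ p ∈ Finset.HasAntidiagonal.antidiagonal n, treeMass ξ A p.1 * forestMass ξ A k p.2 := by
  rw [forestMass, tsum_fin_succ]
  have h : ∀ p : ℕ × ℕ, treeMass ξ A p.1 * forestMass ξ A k p.2
      = ∑' (t : FinTree) (ts : Fin k → FinTree),
        (weight ξ t * (if count A t = p.1 then 1 else 0)) *
          ((∏ i, weight ξ (ts i)) * (if ∑ i, count A (ts i) = p.2 then 1 else 0)) := by
    intro p
    rw [treeMass, forestMass, ← ENNReal.tsum_mul_right]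
    simp_rw [ENNReal.tsum_mul_left]
  simp_rw [h]
  rw [← Summable.tsum_finsetSum fun _ _ => ENNReal.summable]
  refine tsum_congr fun t => ?_
  rw [← Summable.tsum_finsetSum fun _ _ => ENNReal.summable]
  refine tsum_congr fun ts => ?_
  simp_rw [Fin.prod_univ_succ, Fin.sum_univ_succ, Fin.cons_zero, Fin.cons_succ]
  by_cases hn : count A t + ∑ i, count A (ts i) = n
  · rw [if_pos hn, Finset.sum_eq_single (count A t, ∑ i, count A (ts i))]
    · simp
    · rintro ⟨a, b⟩ - hne
      by_cases ha : count A t = a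
      · rw [if_neg (c := ∑ i, count A (ts i) = b), mul_zero, mul_zero]
        rintro rfl
        exact hne (by rw [ha])
      · rw [if_neg ha]; simp
    · intro hc
      exact absurd (Finset.HasAntidiagonal.mem_antidiagonal.2 hn) hc
  · rw [if_neg hn, mul_zero]
    refine (Finset.sum_eq_zero fun p hp => ?_).symm
    by_cases ha : count A t = p.1
    · rw [if_neg (c := ∑ i, count A (ts i) = p.2), mul_zero, mul_zero]
      intro hb
      exact hn (by rw [ha, hb]; exact Finset.HasAntidiagonal.mem_antidiagonal.1 hp)
    · rw [if_neg ha]; simp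

theorem forestMass_eq_zero {A : Set ℕ} (hA : 0 ∈ A) {k n : ℕ} (h : n < k) :
    forestMass ξ A k n = 0 :=
  ENNReal.tsum_eq_zero.2 fun ts => by
    have : k ≤ ∑ i, count A (ts i) := by
      calc k = ∑ _i : Fin k, 1 := by simp
        _ ≤ _ := Finset.sum_le_sum fun i _ => count_pos hA (ts i)
    rw [if_neg (by omega), mul_zero]

/-- The generating series of the number of vertices with out-degree in `A`. -/
def genSeries (ξ : PMF ℕ) (A : Set ℕ) : PowerSeries ℝ :=
  PowerSeries.mk fun n => (treeMass ξ A n).toReal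

theorem coeff_genSeries_pow (A : Set ℕ) (k n : ℕ) :
    (genSeries ξ A ^ k).coeff n = (forestMass ξ A k n).toReal := by
  induction k generalizing n with
  | zero =>
    rw [pow_zero, PowerSeries.coeff_one, forestMass]
    simp only [Finset.univ_eq_empty, Finset.prod_empty, Finset.sum_empty, one_mul]
    rw [tsum_fintype]
    simp only [Finset.univ_unique, Finset.sum_singleton, eq_comm (a := n)]
    split_ifs <;> simp
  | succ k ih =>
    rw [pow_succ', PowerSeries.coeff_mul, forestMass_succ, ENNReal.toReal_sum fun p _ =>
      ENNReal.mul_ne_top (treeMass_ne_top A _) (forestMass_ne_top A _ _)]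
    refine Finset.sum_congr rfl fun p _ => ?_
    rw [ih, ENNReal.toReal_mul, genSeries, PowerSeries.coeff_mk]

/-- Decomposition at the root, which counts itself when its degree `k` is in `A`. The sum stops at
`k = n` because each subtree contains a counted vertex, a leaf. -/
theorem coeff_genSeries {A : Set ℕ} (hA : 0 ∈ A) (n : ℕ) : (genSeries ξ A).coeff n
    = ∑ k ∈ Finset.range (n + 1), (ξ k).toReal *
      (PowerSeries.X ^ (A.indicator (fun _ => 1) k) * genSeries ξ A ^ k : PowerSeries ℝ).coeff n := by
  have h1 : ∀ k : ℕ, (∑' ts : Fin k → FinTree, (∏ i, weight ξ (ts i)) *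
      (if count A (concat ts) = n then 1 else 0))
      = if A.indicator (fun _ => 1) k ≤ n
        then forestMass ξ A k (n - A.indicator (fun _ => 1) k) else 0 := by
    intro k
    split_ifs with h
    · refine tsum_congr fun ts => ?_
      rw [count_concat]
      congr 2
      rw [eq_iff_iff]
      omega
    · refine ENNReal.tsum_eq_zero.2 fun ts => ?_
      rw [count_concat, if_neg (by omega), mul_zero]
  rw [genSeries, PowerSeries.coeff_mk, ← genSeries, treeMass, tsum_weight_mul]
  simp_rw [h1]
  rw [tsum_eq_sum (s := Finset.range (n + 1)), ENNReal.toReal_sum]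
  · refine Finset.sum_congr rfl fun k _ => ?_
    rw [ENNReal.toReal_mul, PowerSeries.coeff_X_pow_mul', coeff_genSeries_pow]
    split_ifs <;> simp
  · intro k _
    refine ENNReal.mul_ne_top (ξ.apply_ne_top k) ?_
    split_ifs
    · exact forestMass_ne_top A _ _
    · simp
  · intro k hk
    rw [Finset.mem_range, not_lt] at hk
    split_ifs
    · rw [forestMass_eq_zero hA (by omega), mul_zero]
    · rw [mul_zero]

/-- The radius of convergence of the generating series is at most `1`. -/
theorem tsum_treeMass_mul_pow (hmean : ∑' k : ℕ, (k : ℝ≥0∞) * ξ k = 1) (hξ : ξ 1 < 1)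
    {A : Set ℕ} (hA : 0 ∈ A) {w : ℝ≥0∞} (hw : w ≠ 0) :
    ∑' n, treeMass ξ A n * (1 + w) ^ n = ∞ := by
  have h1 : ∑' n, treeMass ξ A n * (1 + w) ^ n = ∑' t, weight ξ t * (1 + w) ^ count A t := by
    simp_rw [treeMass, ← ENNReal.tsum_mul_right]
    rw [ENNReal.tsum_comm]
    refine tsum_congr fun t => ?_
    rw [tsum_eq_single (count A t)]
    · simp
    · intro n hn
      rw [if_neg hn.symm]; simp
  rw [h1]
  set y := ∑' t, weight ξ t * (1 + w) ^ count A t with hy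
  by_contra hfin
  have hy1 : 1 ≤ y := by
    rw [← tsum_weight hmean hξ]
    exact ENNReal.tsum_le_tsum fun t => le_mul_of_one_le_right zero_le
      (one_le_pow₀ le_self_add)
  obtain ⟨z, hz⟩ := exists_add_of_le hy1
  have hrec : y = ∑' k, ξ k * ((1 + w) ^ (A.indicator (fun _ => 1) k) * y ^ k) := by
    conv_lhs => rw [hy, tsum_weight_mul]
    refine tsum_congr fun k => ?_
    refine congrArg (ξ k * ·) ?_
    rw [hy, ← tsum_prod_eq_pow, ← ENNReal.tsum_mul_left]
    refine tsum_congr fun ts => ?_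
    rw [count_concat, pow_add, Finset.prod_mul_distrib, Finset.prod_pow_eq_pow_sum]
    ring
  have hbern : ∀ k : ℕ, 1 + (k : ℝ≥0∞) * z ≤ y ^ k := fun k => by
    rw [hz]
    induction k with
    | zero => simp
    | succ k ih =>
      rw [pow_succ]
      calc 1 + ((k + 1 : ℕ) : ℝ≥0∞) * z ≤ (1 + k * z) * (1 + z) := by
            push_cast
            have : (1 + (k : ℝ≥0∞) * z) * (1 + z) = 1 + (k + 1) * z + k * z * z := by ring
            rw [this]
            exact le_self_add
        _ ≤ _ := mul_le_mul_left ih _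
  -- Write `y = 1 + z`. By Bernoulli and mean 1, `∑ ξ k y ^ k ≥ 1 + z = y`, and the factor `1 + w`
  -- at `k = 0` adds `ξ 0 * w > 0`, which is impossible for finite `y`.
  have hlow : y + ξ 0 * w ≤ y := by
    conv_rhs => rw [hrec]
    have e1 : y = ∑' k, ξ k * (1 + k * z) := by
      simp_rw [mul_add, mul_one]
      rw [ENNReal.tsum_add, ξ.tsum_coe, hz]
      congr 1
      have : ∀ k : ℕ, ξ k * (k * z) = (k * ξ k) * z := fun k => by ring
      simp_rw [this]
      rw [ENNReal.tsum_mul_right, hmean, one_mul]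
    have e2 : ξ 0 * w = ∑' k : ℕ, if k = 0 then ξ 0 * w else 0 := (tsum_ite_eq 0 fun _ => ξ 0 * w).symm
    conv_lhs => rw [e1, e2]
    rw [← ENNReal.tsum_add]
    refine ENNReal.tsum_le_tsum fun k => ?_
    rcases k with _ | k
    · simp [hA, mul_add]
    · simp only [Nat.add_eq_zero_iff, one_ne_zero, and_false, if_false, add_zero]
      refine mul_le_mul_right ((hbern _).trans ?_) _
      exact le_mul_of_one_le_left zero_le (one_le_pow₀ le_self_add)
  have hpos : ξ 0 * w ≠ 0 := mul_ne_zero (offspring_zero_ne_zero hmean hξ) hw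
  exact absurd hlow (not_le.2 (ENNReal.lt_add_right hfin hpos))

/-- Otherwise the masses are at most `ρ ^ (n - 1)` for `n ≥ 1` and the generating series converges
at the midpoint of 1 and `1 / ρ`, contrary to `tsum_treeMass_mul_pow`. -/
theorem exists_pow_le_treeMass (hmean : ∑' k : ℕ, (k : ℝ≥0∞) * ξ k = 1) (hξ : ξ 1 < 1)
    {A : Set ℕ} (hA : 0 ∈ A) {ρ : ℝ} (h0 : 0 < ρ) (h1 : ρ < 1) :
    ∃ m : ℕ, 1 ≤ m ∧ ρ ^ m ≤ (treeMass ξ A (m + 1)).toReal := by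
  by_contra! hcon
  have hb : ∀ n, treeMass ξ A n ≤ ENNReal.ofReal (1 / ρ * ρ ^ n) := by
    intro n
    rcases n with _ | _ | n
    · rw [treeMass_zero hA]; exact zero_le
    · rw [zero_add, pow_one, one_div, inv_mul_cancel₀ h0.ne', ENNReal.ofReal_one]
      exact treeMass_le_one A _
    · rw [← ENNReal.ofReal_toReal (treeMass_ne_top A (n + 1 + 1))]
      refine ENNReal.ofReal_le_ofReal ((hcon (n + 1) (by omega)).le.trans (le_of_eq ?_))
      field_simp
      ring
  set x : ℝ := (1 + 1 / ρ) / 2 with hx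
  have hρ : 1 < 1 / ρ := (one_lt_div h0).2 h1
  have hx1 : 1 < x := by rw [hx]; linarith
  have hs : ρ * x < 1 := by
    have : ρ * (1 / ρ) = 1 := by field_simp
    rw [hx]; nlinarith
  have hinf := tsum_treeMass_mul_pow hmean hξ hA (w := ENNReal.ofReal (x - 1))
    (by rw [Ne, ENNReal.ofReal_eq_zero]; linarith)
  have e : 1 + ENNReal.ofReal (x - 1) = ENNReal.ofReal x := by
    rw [← ENNReal.ofReal_one, ← ENNReal.ofReal_add zero_le_one (by linarith)]
    congr 1; ring
  rw [e] at hinf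
  have hle : ∑' n, treeMass ξ A n * ENNReal.ofReal x ^ n
      ≤ ∑' n, ENNReal.ofReal (1 / ρ) * ENNReal.ofReal (ρ * x) ^ n := by
    refine ENNReal.tsum_le_tsum fun n => ?_
    rw [← ENNReal.ofReal_pow (by linarith), ← ENNReal.ofReal_pow (by nlinarith),
      ← ENNReal.ofReal_mul (by positivity), mul_pow, ← mul_assoc,
      ENNReal.ofReal_mul (p := 1 / ρ * ρ ^ n) (by positivity)]
    exact mul_le_mul_left (hb n) _
  rw [hinf, ENNReal.tsum_mul_left, ENNReal.tsum_geometric, top_le_iff] at hle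
  refine ENNReal.mul_ne_top ENNReal.ofReal_ne_top ?_ hle
  rw [ENNReal.inv_ne_top, Ne, tsub_eq_zero_iff_le, not_le]
  exact ENNReal.ofReal_lt_one.2 hs

/-- Ratio limit theorem for the number of vertices with out-degree in `A`. -/
theorem eventually_mul_treeMass_le (hmean : ∑' k : ℕ, (k : ℝ≥0∞) * ξ k = 1) (hξ : ξ 1 < 1)
    {A : Set ℕ} (hA : 0 ∈ A) {d : ℕ} (hd : treeMass ξ A (d + 1) ≠ 0) {r : ℝ≥0∞} (hr : r < 1) :
    ∀ᶠ n in atTop, r * treeMass ξ A (n + d) ≤ treeMass ξ A n := by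
  have h := eventually_mul_coeff_add_le (ξ := fun k => (ξ k).toReal) (A := A)
    (F := genSeries ξ A) (d := d) (r := r.toReal) (fun _ => ENNReal.toReal_nonneg) (fun N => ?_)
    (ENNReal.toReal_pos (offspring_zero_ne_zero hmean hξ) (ξ.apply_ne_top 0)) hA ?_
    (coeff_genSeries hA) (fun ρ h0 h1 => ?_) ?_ ?_
  · filter_upwards [h] with n hn
    rw [genSeries, PowerSeries.coeff_mk, PowerSeries.coeff_mk, ← ENNReal.toReal_mul] at hn
    exact (ENNReal.toReal_le_toReal (ENNReal.mul_ne_top hr.ne_top (treeMass_ne_top A _))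
      (treeMass_ne_top A _)).1 hn
  · rw [← ENNReal.toReal_sum fun k _ => ξ.apply_ne_top k]
    refine ENNReal.toReal_le_of_le_ofReal zero_le_one ?_
    rw [ENNReal.ofReal_one, ← ξ.tsum_coe]
    exact ENNReal.sum_le_tsum _
  · rw [← PowerSeries.coeff_zero_eq_constantCoeff_apply, genSeries, PowerSeries.coeff_mk,
      treeMass_zero hA, ENNReal.toReal_zero]
  · obtain ⟨m, hm, hm2⟩ := exists_pow_le_treeMass hmean hξ hA h0 h1
    exact ⟨m, hm, by rw [genSeries, PowerSeries.coeff_mk]; exact hm2⟩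
  · rw [genSeries, PowerSeries.coeff_mk]
    exact ENNReal.toReal_pos hd (treeMass_ne_top A _)
  · exact (ENNReal.toReal_lt_toReal hr.ne_top ENNReal.one_ne_top).2 hr |>.trans_eq
      ENNReal.toReal_one

end FinTree

/-! ### Kesten's tree as a continuous function of its random inputs -/

namespace PlaneTree

theorem numChildren_infiniteBranch (n : ℕ) :
    infiniteBranch.numChildren (List.replicate n 0) = 1 := by
  have h : {i : ℕ | List.replicate n 0 ++ [i] ∈ infiniteBranch.verts} = {0} := by
    ext i
    constructor
    · rintro ⟨m, hm⟩
      exact (List.eq_replicate_iff.1 hm).2 i (by simp)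
    · rintro rfl
      exact ⟨n + 1, List.replicate_succ'.symm⟩
  rw [numChildren, h, Set.ncard_singleton]

/-- The infinite branch with the root of `S n` glued at height `n`. -/
def branch (S : ℕ → PlaneTree) : PlaneTree := infiniteBranch.graft fun u => S u.1.length

theorem mem_branch {S : ℕ → PlaneTree} {w : List ℕ} : w ∈ (branch S).verts ↔
    (∃ n, w = List.replicate n 0) ∨ ∃ (n j : ℕ) (v : List ℕ),
      w = List.replicate n 0 ++ (1 + j) :: v ∧ j :: v ∈ (S n).verts := by
  constructor
  · rintro (h | ⟨⟨u, n, rfl⟩, j, v, rfl, hm⟩)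
    · exact Or.inl h
    · refine Or.inr ⟨n, j, v, ?_, ?_⟩
      · rw [numChildren_infiniteBranch]
      · simpa using hm
  · rintro (h | ⟨n, j, v, rfl, hm⟩)
    · exact Or.inl h
    · refine Or.inr ⟨⟨List.replicate n 0, n, rfl⟩, j, v, ?_, ?_⟩
      · rw [numChildren_infiniteBranch]
      · simpa using hm

theorem zero_cons_mem_branch {S : ℕ → PlaneTree} {v : List ℕ} :
    0 :: v ∈ (branch S).verts ↔ v ∈ (branch fun n => S (n + 1)).verts := by
  rw [mem_branch, mem_branch]
  constructor
  · rintro (⟨n, h⟩ | ⟨n, j, w, h, hm⟩)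
    · rcases n with _ | n
      · simp at h
      · exact Or.inl ⟨n, (List.cons.inj h).2⟩
    · rcases n with _ | n
      · have := (List.cons.inj h).1
        omega
      · exact Or.inr ⟨n, j, w, (List.cons.inj h).2, hm⟩
  · rintro (⟨n, rfl⟩ | ⟨n, j, w, rfl, hm⟩)
    · exact Or.inl ⟨n + 1, rfl⟩
    · exact Or.inr ⟨n + 1, j, w, rfl, hm⟩

theorem succ_cons_mem_branch {S : ℕ → PlaneTree} {j : ℕ} {v : List ℕ} :
    (j + 1) :: v ∈ (branch S).verts ↔ j :: v ∈ (S 0).verts := by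
  rw [mem_branch]
  constructor
  · rintro (⟨n, h⟩ | ⟨n, j', w, h, hm⟩)
    · rcases n with _ | n
      · simp at h
      · have := (List.cons.inj h).1
        omega
    · rcases n with _ | n
      · obtain ⟨h1, rfl⟩ := List.cons.inj h
        obtain rfl : j = j' := by omega
        exact hm
      · have := (List.cons.inj h).1
        omega
  · intro h
    exact Or.inr ⟨0, j, v, by rw [add_comm]; rfl, h⟩

/-- Self-similarity: the branch occupies the letter 0 at every height, so above its first edge
stands the same construction with shifted inputs, and child `j` of the root of `S 0` becomes child
`j + 1`. -/
theorem branch_eq_concat (S : ℕ → PlaneTree) : branch S =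
    concat (Fin.cons (branch fun n => S (n + 1)) (S 0).subtree :
      Fin ((S 0).numChildren [] + 1) → PlaneTree) := by
  ext w
  rcases w with _ | ⟨_ | j, v⟩
  · simp only [(branch S).root_mem, (concat _).root_mem]
  · rw [zero_cons_mem_branch]
    exact (cons_mem_concat (Fin.cons (branch fun n => S (n + 1)) (S 0).subtree :
      Fin ((S 0).numChildren [] + 1) → PlaneTree) 0 v).symm
  · rw [succ_cons_mem_branch]
    by_cases hj : j < (S 0).numChildren []
    · exact (cons_mem_concat (Fin.cons (branch fun n => S (n + 1)) (S 0).subtree :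
        Fin ((S 0).numChildren [] + 1) → PlaneTree) (Fin.succ ⟨j, hj⟩) v).symm
    · constructor
      · intro h
        exact absurd (((S 0).mem_child_iff (S 0).root_mem j).1
          ((S 0).prefix_mem (u := [j]) (v := v) h)) hj
      · intro h
        have h2 := (singleton_mem_concat _ _).1 ((concat _).prefix_mem (u := [j + 1]) (v := v) h)
        omega

end PlaneTree

namespace UTree

theorem graftOnBranch_eq {τ : ℕ → UTree} {p : ℕ} {σ : Fin p → UTree} (h : τ 0 = concat σ) :
    graftOnBranch τ = concat (Fin.cons (graftOnBranch fun n => τ (n + 1)) σ : Fin (p + 1) → UTree) := by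
  have h1 : graftOnBranch τ = mk (PlaneTree.branch fun n => (τ n).out) := rfl
  have h2 : (fun i => mk ((Fin.cons (PlaneTree.branch fun n => (τ (n + 1)).out)
      (fun i => (σ i).out) : Fin (p + 1) → PlaneTree) i))
      = (Fin.cons (graftOnBranch fun n => τ (n + 1)) σ : Fin (p + 1) → UTree) := by
    funext i
    refine Fin.cases rfl (fun i => ?_) i
    simp only [Fin.cons_succ]
    exact mk_out _
  rw [h1, PlaneTree.branch_eq_concat, ← h2, concat_mk, PlaneTree.mk_eq_mk_iff]
  -- The chosen representative of `τ 0` is only equivalent to a concatenation of those of the `σ i`;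
  -- a permutation of its root subtrees, extended by fixing the branch, repairs this.
  have h3 : (τ 0).out.Equivalent (PlaneTree.concat fun i => (σ i).out) :=
    PlaneTree.mk_eq_mk_iff.1 (by rw [mk_out, h]; rfl)
  obtain ⟨π, hπ⟩ := h3.exists_perm
  refine PlaneTree.Equivalent.concat ((finSuccEquiv _).trans ((Equiv.optionCongr π).trans
    (finSuccEquiv _).symm)) fun i => ?_
  refine Fin.cases ?_ (fun i => ?_) i
  · simp only [Equiv.trans_apply, finSuccEquiv_zero, Equiv.optionCongr_apply, Option.map_none,
      finSuccEquiv_symm_none, Fin.cons_zero]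
    exact PlaneTree.Equivalent.refl _
  · simp only [Equiv.trans_apply, finSuccEquiv_succ, Equiv.optionCongr_apply, Option.map_some,
      finSuccEquiv_symm_some, Fin.cons_succ]
    exact hπ i

/-- The tree with root subtrees `τ, T 0, …, T (p - 1)`. -/
def join (p : ℕ) (τ : UTree) (T : ℕ → UTree) : UTree :=
  concat (Fin.cons τ (fun k : Fin p => T k) : Fin (p + 1) → UTree)

theorem join_trunc_congr {p R : ℕ} {τ σ : UTree} {T S : ℕ → UTree} (h : τ.trunc R = σ.trunc R)
    (hT : ∀ k < p, (T k).trunc R = (S k).trunc R) :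
    (join p τ T).trunc (R + 1) = (join p σ S).trunc (R + 1) := by
  refine trunc_succ_concat_congr fun i => ?_
  refine Fin.cases h (fun i => ?_) i
  exact hT i i.2

/-- The sample space for Kesten's tree: numbers of trees `X n`, and trees `T (n, k)`. -/
abbrev KestenSpace : Type := (ℕ → ℕ) × (ℕ × ℕ → UTree)

/-- Kesten's tree as a function of the random inputs. -/
def kestenTree (ω : KestenSpace) : UTree :=
  graftOnBranch fun n => concat fun k : Fin (ω.1 n) => ω.2 (n, (k : ℕ))

/-- The inputs used above height `1`. -/
def kestenShift (ω : KestenSpace) : KestenSpace :=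
  (fun n => ω.1 (n + 1), fun q => ω.2 (q.1 + 1, q.2))

theorem kestenTree_eq (ω : KestenSpace) :
    kestenTree ω = join (ω.1 0) (kestenTree (kestenShift ω)) fun k => ω.2 (0, k) :=
  graftOnBranch_eq rfl

theorem continuous_kestenShift : Continuous kestenShift := by
  unfold kestenShift
  fun_prop

/-- Induction on `R`: the ball of radius `R + 1` is determined by the number `ω.1 0` of siblings,
the balls of radius `R` of these finitely many trees and that of the shifted Kesten tree. -/
theorem eventually_trunc_kestenTree (R : ℕ) (ω : KestenSpace) :
    ∀ᶠ ω' in 𝓝 ω, (kestenTree ω').trunc R = (kestenTree ω).trunc R := by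
  induction R generalizing ω with
  | zero => exact Eventually.of_forall fun _ => trunc_zero _ _
  | succ R ih =>
    have h1 := continuous_kestenShift.continuousAt.eventually (ih (kestenShift ω))
    have h2 : ∀ᶠ ω' : KestenSpace in 𝓝 ω, ω'.1 0 = ω.1 0 := by
      have : Continuous fun ω' : KestenSpace => ω'.1 0 := by fun_prop
      exact this.tendsto ω ((isOpen_discrete {ω.1 0}).mem_nhds rfl)
    have h3 : ∀ᶠ ω' : KestenSpace in 𝓝 ω, ∀ k ∈ Finset.range (ω.1 0),
        (ω'.2 (0, k)).trunc R = (ω.2 (0, k)).trunc R := by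
      refine (Filter.eventually_all_finset _).2 fun k _ => ?_
      have : Continuous fun ω' : KestenSpace => ω'.2 (0, k) := by fun_prop
      exact this.continuousAt.eventually (eventually_trunc_eq _ R)
    filter_upwards [h1, h2, h3] with ω' h1 h2 h3
    rw [kestenTree_eq, kestenTree_eq ω, h2]
    exact join_trunc_congr h1 fun k hk => h3 k (Finset.mem_range.2 hk)

theorem continuous_of_eventually_trunc_eq {Ω : Type*} [TopologicalSpace Ω] {f : Ω → UTree}
    (h : ∀ (R : ℕ) (ω : Ω), ∀ᶠ ω' in 𝓝 ω, (f ω').trunc R = (f ω).trunc R) : Continuous f := by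
  refine continuous_iff_continuousAt.2 fun ω U hU => ?_
  obtain ⟨R, hR⟩ := exists_trunc_mem hU
  exact mem_of_superset (h R ω) fun ω' hω' => hR _ hω'

theorem continuous_kestenTree : Continuous kestenTree :=
  continuous_of_eventually_trunc_eq eventually_trunc_kestenTree

theorem measurable_kestenTree : Measurable kestenTree := continuous_kestenTree.measurable

theorem continuous_join :
    Continuous fun x : ℕ × UTree × (ℕ → UTree) => join x.1 x.2.1 x.2.2 := by
  refine continuous_of_eventually_trunc_eq fun R x => ?_
  rcases R with _ | R
  · exact Eventually.of_forall fun _ => trunc_zero _ _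
  have h1 : ∀ᶠ y : ℕ × UTree × (ℕ → UTree) in 𝓝 x, y.1 = x.1 :=
    continuous_fst.tendsto x ((isOpen_discrete {x.1}).mem_nhds rfl)
  have h2 : ∀ᶠ y : ℕ × UTree × (ℕ → UTree) in 𝓝 x, y.2.1.trunc R = x.2.1.trunc R := by
    have : Continuous fun y : ℕ × UTree × (ℕ → UTree) => y.2.1 := by fun_prop
    exact this.continuousAt.eventually (eventually_trunc_eq _ R)
  have h3 : ∀ᶠ y : ℕ × UTree × (ℕ → UTree) in 𝓝 x, ∀ k ∈ Finset.range x.1,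
      (y.2.2 k).trunc R = (x.2.2 k).trunc R := by
    refine (Filter.eventually_all_finset _).2 fun k _ => ?_
    have : Continuous fun y : ℕ × UTree × (ℕ → UTree) => y.2.2 k := by fun_prop
    exact this.continuousAt.eventually (eventually_trunc_eq _ R)
  filter_upwards [h1, h2, h3] with y h1 h2 h3
  rw [h1]
  exact join_trunc_congr h2 fun k hk => h3 k (Finset.mem_range.2 hk)

end UTree

/-! ### Product measures and the laws of the inputs -/

open Measure in
/-- Splitting the coordinates of a product measure into two blocks. -/
theorem infinitePi_map_split {ι κ l X : Type*} [MeasurableSpace X] (μ : Measure X)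
    [IsProbabilityMeasure μ] (e : κ ⊕ l ≃ ι) :
    (infinitePi fun _ : ι => μ).map (fun x => (fun k => x (e (Sum.inl k)), fun j => x (e (Sum.inr j))))
      = (infinitePi fun _ : κ => μ).prod (infinitePi fun _ : l => μ) := by
  have hmeas : Measurable fun (y : (κ → X) × (l → X)) (i : ι) => Sum.elim y.1 y.2 (e.symm i) := by
    refine measurable_pi_lambda _ fun i => ?_
    rcases e.symm i with k | j
    · exact (measurable_pi_apply k).comp measurable_fst
    · exact (measurable_pi_apply j).comp measurable_snd
  -- The inverse, merging map is treated first, since an infinite product measure is characterised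
  -- by its values on finite boxes.
  have h : ((infinitePi fun _ : κ => μ).prod (infinitePi fun _ : l => μ)).map
      (fun y (i : ι) => Sum.elim y.1 y.2 (e.symm i)) = infinitePi fun _ : ι => μ := by
    classical
    refine eq_infinitePi _ fun s t ht => ?_
    rw [map_apply hmeas (.pi s.countable_toSet fun i _ => ht i)]
    have h1 : (fun y : (κ → X) × (l → X) => fun i : ι => Sum.elim y.1 y.2 (e.symm i)) ⁻¹' (s : Set ι).pi t
        = ((s.map e.symm.toEmbedding).toLeft : Set κ).pi (fun k => t (e (Sum.inl k))) ×ˢ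
          ((s.map e.symm.toEmbedding).toRight : Set l).pi (fun j => t (e (Sum.inr j))) := by
      ext y
      simp only [Set.mem_preimage, Set.mem_pi, Set.mem_prod, Finset.mem_coe, Finset.mem_toLeft,
        Finset.mem_toRight, Finset.mem_map_equiv, Equiv.symm_symm]
      constructor
      · intro hy
        exact ⟨fun k hk => by simpa using hy _ hk, fun j hj => by simpa using hy _ hj⟩
      · rintro ⟨h1, h2⟩ i hi
        obtain ⟨x, rfl⟩ := e.surjective i
        rw [Equiv.symm_apply_apply]
        rcases x with k | j
        · exact h1 k hi
        · exact h2 j hi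
    rw [h1, prod_prod, infinitePi_pi _ fun k _ => ht _, infinitePi_pi _ fun j _ => ht _]
    have h2 := Finset.prod_disjSum (s.map e.symm.toEmbedding).toLeft
      (s.map e.symm.toEmbedding).toRight fun x => μ (t (e x))
    rw [Finset.toLeft_disjSum_toRight, Finset.prod_map] at h2
    simpa using h2.symm
  rw [← h, map_map (by fun_prop) hmeas]
  convert Measure.map_id using 2
  funext y
  simp

instance : MeasurableSpace FinTree := ⊤

instance : MeasurableSingletonClass FinTree := ⟨fun _ => trivial⟩

section Laws

variable {ξ : PMF ℕ}

theorem lintegral_gw {φ : UTree → ℝ≥0∞} (hφ : Measurable φ) :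
    ∫⁻ τ, φ τ ∂gw ξ = ∑' t : FinTree, t.weight ξ * φ (UTree.mk t.1) := by
  rw [gw, lintegral_sum_measure]
  refine tsum_congr fun t => ?_
  rw [lintegral_smul_measure, lintegral_dirac' _ hφ]
  rfl

theorem gw_apply {B : Set UTree} (hB : MeasurableSet B) :
    gw ξ B = ∑' t : FinTree, t.weight ξ * B.indicator 1 (UTree.mk t.1) := by
  rw [← lintegral_indicator_one hB, lintegral_gw (measurable_one.indicator hB)]

theorem isProbabilityMeasure_gw (hmean : ∑' k : ℕ, (k : ℝ≥0∞) * ξ k = 1) (hξ : ξ 1 < 1) :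
    IsProbabilityMeasure (gw ξ) := by
  refine ⟨?_⟩
  rw [gw_apply MeasurableSet.univ]
  simpa using FinTree.tsum_weight hmean hξ

/-- The size-biased law gives no mass to `k = 0`, so the truncated subtraction there is harmless. -/
theorem lintegral_sizeBiased (g : ℕ → ℝ≥0∞) :
    ∫⁻ k, g k ∂(sizeBiased ξ).map (fun k => k - 1)
      = ∑' m : ℕ, ((m + 1 : ℕ) : ℝ≥0∞) * ξ (m + 1) * g m := by
  rw [lintegral_map (measurable_from_nat) (measurable_from_nat), sizeBiased, lintegral_sum_measure,
    tsum_eq_zero_add' ENNReal.summable]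
  simp

theorem isProbabilityMeasure_sizeBiased (hmean : ∑' k : ℕ, (k : ℝ≥0∞) * ξ k = 1) :
    IsProbabilityMeasure ((sizeBiased ξ).map (fun k => k - 1)) := by
  refine ⟨?_⟩
  rw [← lintegral_one, lintegral_sizeBiased]
  rw [tsum_eq_zero_add' ENNReal.summable] at hmean
  simpa using hmean

/-- The law of `mk t` for the weight on finite plane trees is `GW`. -/
theorem gw_eq_map : gw ξ =
    (Measure.sum fun t : FinTree => t.weight ξ • Measure.dirac t).map (fun t => UTree.mk t.1) := by
  ext B hB
  rw [Measure.map_apply measurable_from_top hB, Measure.sum_apply _ (MeasurableSet.of_discrete), gw_apply hB]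
  simp [Set.indicator]
  rfl

/-- `gw ξ` is the image of a law on the countable discrete space `FinTree`, where integrals against
finite products are sums over forests. -/
theorem lintegral_pi_gw (hmean : ∑' k : ℕ, (k : ℝ≥0∞) * ξ k = 1) (hξ : ξ 1 < 1) (m : ℕ)
    {φ : (Fin m → UTree) → ℝ≥0∞} (hφ : Measurable φ) :
    ∫⁻ T, φ T ∂(Measure.infinitePi fun _ : Fin m => gw ξ)
      = ∑' ts : Fin m → FinTree, (∏ i, (ts i).weight ξ) * φ fun i => UTree.mk (ts i).1 := by
  set ν : Measure FinTree := Measure.sum fun t : FinTree => t.weight ξ • Measure.dirac t with hν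
  have hνs : ∀ t, ν {t} = t.weight ξ := fun t => by
    rw [hν, Measure.sum_apply _ (MeasurableSet.of_discrete), tsum_eq_single t]
    · simp
    · intro s hs
      simp [hs]
  have hprob : IsProbabilityMeasure ν := by
    refine ⟨?_⟩
    rw [hν, Measure.sum_apply _ (MeasurableSet.of_discrete)]
    simpa using FinTree.tsum_weight hmean hξ
  have h1 : (Measure.infinitePi fun _ : Fin m => gw ξ)
      = (Measure.infinitePi fun _ : Fin m => ν).map (fun ts i => UTree.mk (ts i).1) := by
    rw [Measure.infinitePi_map_pi (fun _ : Fin m => ν) (f := fun _ t => UTree.mk t.1)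
      fun _ => measurable_from_top, gw_eq_map]
  rw [h1, lintegral_map hφ (by
    refine measurable_pi_lambda _ fun i => ?_
    exact (measurable_from_top (f := fun t : FinTree => UTree.mk t.1)).comp (measurable_pi_apply i)),
    lintegral_countable']
  refine tsum_congr fun ts => ?_
  rw [Measure.infinitePi_singleton_of_fintype, mul_comm]
  simp_rw [hνs]

end Laws

/-- Separating the inputs with first index `0` in two independent i.i.d. families. -/
theorem lintegral_infinitePi_split {α β : Type*} [MeasurableSpace α] [MeasurableSpace β]
    (ν : Measure α) [IsProbabilityMeasure ν] (μ : Measure β) [IsProbabilityMeasure μ]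
    {F : α × (ℕ → α) × (ℕ → β) × (ℕ × ℕ → β) → ℝ≥0∞} (hF : Measurable F) :
    ∫⁻ X : ℕ → α, ∫⁻ T : ℕ × ℕ → β,
        F (X 0, fun n => X (n + 1), fun k => T (0, k), fun q => T (q.1 + 1, q.2))
        ∂(Measure.infinitePi fun _ => μ) ∂(Measure.infinitePi fun _ => ν)
      = ∫⁻ x, ∫⁻ S : ℕ → β, ∫⁻ X : ℕ → α, ∫⁻ T : ℕ × ℕ → β, F (x, X, S, T)
        ∂(Measure.infinitePi fun _ => μ) ∂(Measure.infinitePi fun _ => ν)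
        ∂(Measure.infinitePi fun _ => μ) ∂ν := by
  have hT := infinitePi_map_split μ (κ := ℕ) (l := ℕ × ℕ)
    ⟨Sum.elim (fun k => (0, k)) (fun q => (q.1 + 1, q.2)),
      fun q => match q with
        | (0, k) => Sum.inl k
        | (n + 1, k) => Sum.inr (n, k),
      by rintro (k | ⟨n, k⟩) <;> rfl, by rintro ⟨_ | n, k⟩ <;> rfl⟩
  have hX := infinitePi_map_split ν (κ := Unit) (l := ℕ)
    ⟨Sum.elim (fun _ => 0) (fun n => n + 1),
      fun q => match q with
        | 0 => Sum.inl ()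
        | n + 1 => Sum.inr n,
      by rintro (⟨⟩ | n) <;> rfl, by rintro (_ | n) <;> rfl⟩
  simp only [Equiv.coe_fn_mk, Sum.elim_inl, Sum.elim_inr] at hT hX
  have e1 : ∀ X : ℕ → α, ∫⁻ T : ℕ × ℕ → β,
        F (X 0, fun n => X (n + 1), fun k => T (0, k), fun q => T (q.1 + 1, q.2))
        ∂(Measure.infinitePi fun _ => μ)
      = ∫⁻ S : ℕ → β, ∫⁻ T : ℕ × ℕ → β, F (X 0, fun n => X (n + 1), S, T)
        ∂(Measure.infinitePi fun _ => μ) ∂(Measure.infinitePi fun _ => μ) := by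
    intro X
    have hm : Measurable fun y : (ℕ → β) × (ℕ × ℕ → β) => F (X 0, fun n => X (n + 1), y) :=
      hF.comp (by fun_prop)
    have h2 := lintegral_prod (μ := Measure.infinitePi fun _ : ℕ => μ)
      (ν := Measure.infinitePi fun _ : ℕ × ℕ => μ) _ hm.aemeasurable
    rw [← h2, ← hT, lintegral_map hm (by fun_prop)]
  simp_rw [e1]
  have hG : Measurable fun y : α × (ℕ → α) => ∫⁻ S : ℕ → β, ∫⁻ T : ℕ × ℕ → β, F (y.1, y.2, S, T)
      ∂(Measure.infinitePi fun _ => μ) ∂(Measure.infinitePi fun _ => μ) := by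
    refine Measurable.lintegral_prod_right ?_
    refine Measurable.lintegral_prod_right ?_
    exact hF.comp (by fun_prop)
  set G := fun y : α × (ℕ → α) => ∫⁻ S : ℕ → β, ∫⁻ T : ℕ × ℕ → β, F (y.1, y.2, S, T)
      ∂(Measure.infinitePi fun _ => μ) ∂(Measure.infinitePi fun _ => μ) with hGdef
  have hG2 : Measurable fun z : (Unit → α) × (ℕ → α) => G (z.1 (), z.2) :=
    hG.comp (by fun_prop)
  have hev := Measure.infinitePi_map_eval (fun _ : Unit => ν) ()
  have e2 : ∫⁻ X : ℕ → α, G (X 0, fun n => X (n + 1)) ∂(Measure.infinitePi fun _ => ν)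
      = ∫⁻ x, ∫⁻ X : ℕ → α, G (x, X) ∂(Measure.infinitePi fun _ => ν) ∂ν := by
    have hm : Measurable fun x => ∫⁻ X : ℕ → α, G (x, X) ∂(Measure.infinitePi fun _ => ν) :=
      hG.lintegral_prod_right'
    have h2 := lintegral_prod (μ := Measure.infinitePi fun _ : Unit => ν)
      (ν := Measure.infinitePi fun _ : ℕ => ν) _ hG2.aemeasurable
    have h3 := lintegral_map (μ := Measure.infinitePi fun _ : Unit => ν) hm
      (by fun_prop : Measurable fun y : Unit → α => y ())
    rw [hev] at h3
    rw [h3, ← h2, ← hX, lintegral_map hG2 (by fun_prop)]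
  refine e2.trans (lintegral_congr fun x => ?_)
  rw [hGdef]
  refine lintegral_lintegral_swap (f := fun (X : ℕ → α) (S : ℕ → β) => ∫⁻ T : ℕ × ℕ → β,
    F (x, X, S, T) ∂(Measure.infinitePi fun _ => μ)) (Measurable.aemeasurable ?_)
  refine Measurable.lintegral_prod_right ?_
  exact hF.comp (by fun_prop)

/-! ### Recursion for Kesten's law -/

section Kesten

variable {ξ : PMF ℕ}

theorem isProbabilityMeasure_kesten (hmean : ∑' k : ℕ, (k : ℝ≥0∞) * ξ k = 1) (hξ : ξ 1 < 1) :
    IsProbabilityMeasure (kesten ξ) := by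
  have := isProbabilityMeasure_gw hmean hξ
  have := isProbabilityMeasure_sizeBiased hmean
  exact Measure.isProbabilityMeasure_map UTree.measurable_kestenTree.aemeasurable

theorem lintegral_kesten (hmean : ∑' k : ℕ, (k : ℝ≥0∞) * ξ k = 1) (hξ : ξ 1 < 1)
    {φ : UTree → ℝ≥0∞} (hφ : Measurable φ) :
    ∫⁻ τ, φ τ ∂kesten ξ = ∫⁻ X, ∫⁻ T, φ (UTree.kestenTree (X, T))
      ∂(Measure.infinitePi fun _ : ℕ × ℕ => gw ξ)
        ∂(Measure.infinitePi fun _ : ℕ => (sizeBiased ξ).map fun k => k - 1) := by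
  have := isProbabilityMeasure_gw hmean hξ
  have := isProbabilityMeasure_sizeBiased hmean
  exact (lintegral_map hφ UTree.measurable_kestenTree).trans
    (lintegral_prod _ (hφ.comp UTree.measurable_kestenTree).aemeasurable)

open UTree in
/-- Recursive description of Kesten's law, according to the children of the root. -/
theorem lintegral_kesten_eq (hmean : ∑' k : ℕ, (k : ℝ≥0∞) * ξ k = 1) (hξ : ξ 1 < 1)
    {φ : UTree → ℝ≥0∞} (hφ : Measurable φ) :
    ∫⁻ τ, φ τ ∂kesten ξ = ∑' (m : ℕ) (ts : Fin m → FinTree),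
      ((m + 1 : ℕ) : ℝ≥0∞) * ξ (m + 1) * (∏ i, (ts i).weight ξ) *
        ∫⁻ τ, φ (concat (Fin.cons τ (fun i => mk (ts i).1) : Fin (m + 1) → UTree)) ∂kesten ξ := by
  have := isProbabilityMeasure_gw hmean hξ
  have := isProbabilityMeasure_sizeBiased hmean
  have := isProbabilityMeasure_kesten hmean hξ
  set ν := (sizeBiased ξ).map (fun k => k - 1) with hν
  have hF : Measurable fun x : ℕ × UTree × (ℕ → UTree) => φ (join x.1 x.2.1 x.2.2) :=
    hφ.comp continuous_join.measurable
  have hkt := measurable_kestenTree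
  have hm2 : Measurable fun z : ℕ × (ℕ → ℕ) × (ℕ → UTree) × (ℕ × ℕ → UTree) =>
      φ (join z.1 (kestenTree (z.2.1, z.2.2.2)) z.2.2.1) :=
    hF.comp (measurable_fst.prodMk ((hkt.comp (by fun_prop)).prodMk (by fun_prop)))
  rw [lintegral_kesten hmean hξ hφ, ← hν]
  have e1 : ∀ X T, φ (kestenTree (X, T)) = φ (join (X 0)
      (kestenTree (fun n => X (n + 1), fun q => T (q.1 + 1, q.2))) fun k => T (0, k)) :=
    fun X T => by rw [kestenTree_eq]; rfl
  simp_rw [e1]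
  rw [lintegral_infinitePi_split ν (gw ξ) hm2, hν, lintegral_sizeBiased, ← hν]
  -- The shifted inputs have the law of the original ones, so the tree above the first edge is again
  -- a Kesten tree.
  have e2 : ∀ x : ℕ, ∀ S : ℕ → UTree, ∫⁻ X, ∫⁻ T, φ (join x (kestenTree (X, T)) S)
      ∂(Measure.infinitePi fun _ : ℕ × ℕ => gw ξ) ∂(Measure.infinitePi fun _ : ℕ => ν)
      = ∫⁻ τ, φ (join x τ S) ∂kesten ξ := by
    intro x S
    have hm : Measurable fun τ => φ (join x τ S) :=
      hF.comp (measurable_const.prodMk (measurable_id.prodMk measurable_const))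
    rw [lintegral_kesten hmean hξ hm, ← hν]
  simp only [e2]
  refine tsum_congr fun x => ?_
  -- `join x` reads only `x` entries of the sequence; padding with an arbitrary tree transfers
  -- measurability to finite families.
  let ext : (Fin x → UTree) → ℕ → UTree := fun T k =>
    if h : k < x then T ⟨k, h⟩ else mk PlaneTree.infiniteBranch
  have hext : Measurable ext := measurable_pi_lambda _ fun k => by
    by_cases h : k < x
    · simp only [ext, dif_pos h]; fun_prop
    · simp only [ext, dif_neg h]; fun_prop
  have hjoin : ∀ τ T, join x τ (ext T) = concat (Fin.cons τ T : Fin (x + 1) → UTree) := by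
    intro τ T
    simp [UTree.join, ext]
  have hΘ : Measurable fun T : Fin x → UTree =>
      ∫⁻ τ, φ (concat (Fin.cons τ T : Fin (x + 1) → UTree)) ∂kesten ξ := by
    simp_rw [← hjoin]
    refine Measurable.lintegral_prod_right ?_
    exact hF.comp (measurable_const.prodMk (measurable_snd.prodMk (hext.comp measurable_fst)))
  have hr := Measure.map_infinitePi_infinitePi_of_inj (P := fun _ : ℕ => gw ξ)
    (f := fun i : Fin x => (i : ℕ)) Fin.val_injective
  have e3 : ∫⁻ S, ∫⁻ τ, φ (join x τ S) ∂kesten ξ ∂(Measure.infinitePi fun _ : ℕ => gw ξ)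
      = ∫⁻ T, ∫⁻ τ, φ (concat (Fin.cons τ T : Fin (x + 1) → UTree)) ∂kesten ξ
        ∂(Measure.infinitePi fun _ : Fin x => gw ξ) := by
    rw [← hr, lintegral_map hΘ (by fun_prop)]
    rfl
  rw [e3, lintegral_pi_gw hmean hξ x hΘ, ← ENNReal.tsum_mul_left]
  refine tsum_congr fun ts => ?_
  ring

end Kesten

/-! ### Lower bounds through a dominant root subtree -/

namespace FinTree

variable {ξ : PMF ℕ}

/-- The integral of `φ` for the Galton-Watson law restricted to the trees with `n` vertices having
out-degree in `A`. -/
def treeSum (ξ : PMF ℕ) (A : Set ℕ) (φ : UTree → ℝ≥0∞) (n : ℕ) : ℝ≥0∞ :=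
  ∑' t, weight ξ t * ((if count A t = n then 1 else 0) * φ (UTree.mk t.1))

theorem mk_concat {m : ℕ} (ts : Fin m → FinTree) :
    UTree.mk (concat ts).1 = UTree.concat fun i => UTree.mk (ts i).1 :=
  (UTree.concat_mk fun i => (ts i).1).symm

theorem mk_concat_cons {m : ℕ} (t : FinTree) (ts : Fin m → FinTree) :
    UTree.mk (concat (Fin.cons t ts : Fin (m + 1) → FinTree)).1
      = UTree.concat (Fin.cons (UTree.mk t.1) (fun i => UTree.mk (ts i).1) :
        Fin (m + 1) → UTree) := by
  rw [mk_concat]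
  congr 1
  funext i
  refine Fin.cases rfl (fun i => rfl) i

/-- For a symmetric function of the subtrees, it is `m + 1` times as likely that some subtree is
dominant as that the first one is. -/
theorem mul_tsum_dominant_le {α : Type*} {m : ℕ} (N : α → ℕ) (g : (Fin (m + 1) → α) → ℝ≥0∞)
    (hg : ∀ (π : Equiv.Perm (Fin (m + 1))) (ts : Fin (m + 1) → α), g (fun i => ts (π i)) = g ts) :
    ((m + 1 : ℕ) : ℝ≥0∞) * ∑' ts, g ts * (if ∑ i, N (ts i) < 2 * N (ts 0) then 1 else 0)
      ≤ ∑' ts, g ts := by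
  have hsym : ∀ j : Fin (m + 1), ∑' ts, g ts * (if ∑ i, N (ts i) < 2 * N (ts j) then 1 else 0)
      = ∑' ts, g ts * (if ∑ i, N (ts i) < 2 * N (ts 0) then 1 else 0) := by
    intro j
    rw [← ((Equiv.swap 0 j).arrowCongr (Equiv.refl α)).tsum_eq]
    refine tsum_congr fun ts => ?_
    have e : ∀ i, ((Equiv.swap 0 j).arrowCongr (Equiv.refl α)) ts i = ts (Equiv.swap 0 j i) := by
      intro i
      simp [Equiv.arrowCongr]
    have e2 : ((Equiv.swap 0 j).arrowCongr (Equiv.refl α)) ts = fun i => ts (Equiv.swap 0 j i) :=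
      funext e
    rw [e2, hg]
    simp only [Equiv.swap_apply_right]
    rw [Equiv.sum_comp (Equiv.swap 0 j) fun i => N (ts i)]
  calc ((m + 1 : ℕ) : ℝ≥0∞) * ∑' ts, g ts * (if ∑ i, N (ts i) < 2 * N (ts 0) then 1 else 0)
      = ∑ j : Fin (m + 1), ∑' ts, g ts * (if ∑ i, N (ts i) < 2 * N (ts j) then 1 else 0) := by
        simp_rw [hsym]
        simp
    _ = ∑' ts, g ts * ∑ j : Fin (m + 1), (if ∑ i, N (ts i) < 2 * N (ts j) then 1 else 0) := by
        rw [← Summable.tsum_finsetSum fun _ _ => ENNReal.summable]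
        simp_rw [Finset.mul_sum]
    _ ≤ ∑' ts, g ts := by
        refine ENNReal.tsum_le_tsum fun ts => mul_le_of_le_one_right zero_le ?_
        rw [Finset.sum_boole]
        -- Two distinct indices cannot both carry more than half of the total.
        have : (Finset.univ.filter fun j : Fin (m + 1) => ∑ i, N (ts i) < 2 * N (ts j)).card ≤ 1 := by
          refine Finset.card_le_one.2 fun a ha b hb => ?_
          by_contra hne
          have h1 := (Finset.mem_filter.1 ha).2
          have h2 := (Finset.mem_filter.1 hb).2
          have h3 : ∑ i ∈ {a, b}, N (ts i) ≤ ∑ i, N (ts i) :=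
            Finset.sum_le_sum_of_subset (Finset.subset_univ _)
          rw [Finset.sum_pair hne] at h3
          omega
        exact_mod_cast this

/-- The number of vertices with out-degree in `A` which are not descendants of the first child of
the root, when the other subtrees are `ts`. -/
def shift (A : Set ℕ) (x : Σ m, Fin m → FinTree) : ℕ :=
  A.indicator (fun _ => 1) (x.1 + 1) + ∑ i, count A (x.2 i)

/-- The size-biased weight of the siblings `ts` of the first child of the root in Kesten's tree. -/
def biasedWeight (ξ : PMF ℕ) (x : Σ m, Fin m → FinTree) : ℝ≥0∞ :=
  ((x.1 + 1 : ℕ) : ℝ≥0∞) * ξ (x.1 + 1) * ∏ i, weight ξ (x.2 i)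

/-- Adding siblings to a tree. -/
def addSiblings (x : Σ m, Fin m → FinTree) (τ : UTree) : UTree :=
  UTree.concat (Fin.cons τ (fun i => UTree.mk (x.2 i).1) : Fin (x.1 + 1) → UTree)

/-- Trees without a dominant root subtree are discarded. Weight, count and test function do not
depend on the order of the subtrees, so the dominant one may be put first, and the resulting factor
`m + 1` turns `ξ (m + 1)` into the size-biased weight. -/
theorem tsum_dominant_le_treeSum (A : Set ℕ) (φ : UTree → ℝ≥0∞) (n : ℕ) :
    ∑' x, biasedWeight ξ x * ∑' t, weight ξ t * ((if count A t + shift A x = n then 1 else 0) *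
      ((if ∑ i, count A (x.2 i) < count A t then 1 else 0) * φ (addSiblings x (UTree.mk t.1))))
      ≤ treeSum ξ A φ n := by
  rw [treeSum, tsum_weight_mul, tsum_eq_zero_add' ENNReal.summable]
  refine le_trans ?_ le_add_self
  rw [ENNReal.tsum_sigma']
  refine ENNReal.tsum_le_tsum fun m => ?_
  set g : (Fin (m + 1) → FinTree) → ℝ≥0∞ := fun ts => (∏ i, weight ξ (ts i)) *
    ((if count A (concat ts) = n then 1 else 0) * φ (UTree.mk (concat ts).1)) with hg
  have hsymm : ∀ (π : Equiv.Perm (Fin (m + 1))) (ts : Fin (m + 1) → FinTree),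
      g (fun i => ts (π i)) = g ts := by
    intro π ts
    simp only [hg]
    rw [Equiv.prod_comp π fun i => weight ξ (ts i), count_concat, count_concat,
      Equiv.sum_comp π fun i => count A (ts i), mk_concat, mk_concat,
      UTree.concat_perm π fun i => UTree.mk (ts i).1]
  have h := mul_tsum_dominant_le (count A) g hsymm
  refine le_trans (le_of_eq ?_) (mul_le_mul_right h _)
  rw [tsum_fin_succ, ENNReal.tsum_comm, ← mul_assoc, ← ENNReal.tsum_mul_left]
  refine tsum_congr fun ts => ?_
  rw [← ENNReal.tsum_mul_left, ← ENNReal.tsum_mul_left]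
  refine tsum_congr fun t => ?_
  simp only [hg, biasedWeight, shift, addSiblings, mk_concat_cons, count_concat,
    Fin.prod_univ_succ, Fin.sum_univ_succ, Fin.cons_zero, Fin.cons_succ]
  have e1 : (count A t + (A.indicator (fun _ => 1) (m + 1) + ∑ i, count A (ts i)) = n)
      = (A.indicator (fun _ => 1) (m + 1) + (count A t + ∑ i, count A (ts i)) = n) := by
    rw [eq_iff_iff]; omega
  have e2 : (count A t + ∑ i, count A (ts i) < 2 * count A t)
      = (∑ i, count A (ts i) < count A t) := by
    rw [eq_iff_iff]; omega
  simp only [e1, e2]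
  ring

/-- For finitely many sibling families and `n` large, a first subtree with count `n - shift A x`
outweighs its siblings, so the dominance condition disappears. -/
theorem sum_le_treeSum (A : Set ℕ) (φ : UTree → ℝ≥0∞) (S : Finset (Σ m, Fin m → FinTree)) :
    ∀ᶠ n in atTop, ∑ x ∈ S, biasedWeight ξ x *
      treeSum ξ A (fun τ => φ (addSiblings x τ)) (n - shift A x) ≤ treeSum ξ A φ n := by
  have h : ∀ᶠ n in atTop, ∀ x ∈ S, shift A x + ∑ i, count A (x.2 i) < n :=
    (Filter.eventually_all_finset S).2 fun x _ => eventually_gt_atTop _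
  filter_upwards [h] with n hn
  refine le_trans ?_ (tsum_dominant_le_treeSum A φ n)
  refine le_trans (Finset.sum_le_sum fun x hx => ?_) (ENNReal.sum_le_tsum S)
  refine mul_le_mul_right (ENNReal.tsum_le_tsum fun t => mul_le_mul_right ?_ _) _
  have h1 := hn x hx
  by_cases h2 : count A t = n - shift A x
  · rw [if_pos h2, if_pos (by omega), if_pos (by omega), one_mul, one_mul]
  · rw [if_neg h2, zero_mul]
    exact zero_le

/-- A single leaf in the place of the first subtree gives a tree of positive weight. This makes `d =
shift A x` admissible in the ratio limit theorem. -/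
theorem treeMass_shift_ne_zero (h0 : ξ 0 ≠ 0) {A : Set ℕ} (hA : 0 ∈ A)
    {x : Σ m, Fin m → FinTree} (hx : biasedWeight ξ x ≠ 0) :
    treeMass ξ A (shift A x + 1) ≠ 0 := by
  obtain ⟨m, ts⟩ := x
  set leaf : FinTree := concat (Fin.elim0 : Fin 0 → FinTree) with hleaf
  have h1 := ENNReal.le_tsum (f := fun t => weight ξ t *
    (if count A t = shift A ⟨m, ts⟩ + 1 then 1 else 0)) (concat (Fin.cons leaf ts : Fin (m + 1) → FinTree))
  refine (lt_of_lt_of_le (pos_iff_ne_zero.2 ?_) h1).ne'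
  have h2 : count A (concat (Fin.cons leaf ts : Fin (m + 1) → FinTree)) = shift A ⟨m, ts⟩ + 1 := by
    rw [count_concat, Fin.sum_univ_succ, Fin.cons_zero, hleaf, count_concat]
    simp only [Set.indicator_of_mem hA, Finset.univ_eq_empty, Finset.sum_empty, Fin.cons_succ, shift]
    ring
  rw [if_pos h2, mul_one, weight_concat, Fin.prod_univ_succ, Fin.cons_zero, hleaf, weight_concat]
  simp only [Fin.cons_succ, Finset.univ_eq_empty, Finset.prod_empty, mul_one]
  simp only [biasedWeight] at hx
  have h3 := right_ne_zero_of_mul hx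
  have h4 := right_ne_zero_of_mul (left_ne_zero_of_mul hx)
  exact mul_ne_zero h4 (mul_ne_zero h0 h3)

end FinTree

/-- Asymptotic lower bounds relative to `f` can be added up. -/
theorem eventually_mul_le_sum {ι : Type*} {f : ℕ → ℝ≥0∞} {I : ι → ℝ≥0∞} {V : ι → ℕ → ℝ≥0∞}
    (h : ∀ x, ∀ b < I x, ∀ᶠ n in atTop, b * f n ≤ V x n) (S : Finset ι) :
    ∀ b < ∑ x ∈ S, I x, ∀ᶠ n in atTop, b * f n ≤ ∑ x ∈ S, V x n := by
  classical
  induction S using Finset.induction_on with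
  | empty => intro b hb; simp at hb
  | insert x S hx ih =>
    intro b hb
    rw [Finset.sum_insert hx] at hb
    simp_rw [Finset.sum_insert hx]
    by_cases h1 : I x = 0
    · rw [h1, zero_add] at hb
      filter_upwards [ih b hb] with n hn using hn.trans le_add_self
    by_cases h2 : ∑ x ∈ S, I x = 0
    · rw [h2, add_zero] at hb
      filter_upwards [h x b hb] with n hn using hn.trans le_self_add
    obtain ⟨c, hc, d, hd, hcd⟩ := ENNReal.exists_lt_add_of_lt_add hb h1 h2
    filter_upwards [h x c hc, ih d hd] with n hn hn2
    calc b * f n ≤ (c + d) * f n := mul_le_mul_left hcd.le _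
      _ = c * f n + d * f n := add_mul _ _ _
      _ ≤ _ := add_le_add hn hn2

namespace FinTree

variable {ξ : PMF ℕ}

theorem dependsOnBall_addSiblings {R : ℕ} {φ : UTree → ℝ≥0∞}
    (hφ : UTree.DependsOnBall (R + 1) φ) (x : Σ m, Fin m → FinTree) :
    UTree.DependsOnBall R fun τ => φ (addSiblings x τ) := by
  intro τ σ h
  refine hφ _ _ (UTree.trunc_succ_concat_congr fun i => ?_)
  exact Fin.cases h (fun _ => rfl) i

theorem lintegral_kesten_eq_tsum (hmean : ∑' k : ℕ, (k : ℝ≥0∞) * ξ k = 1) (hξ : ξ 1 < 1)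
    {φ : UTree → ℝ≥0∞} (hφ : Measurable φ) : ∫⁻ τ, φ τ ∂kesten ξ
      = ∑' x, biasedWeight ξ x * ∫⁻ τ, φ (addSiblings x τ) ∂kesten ξ := by
  rw [lintegral_kesten_eq hmean hξ hφ, ENNReal.tsum_sigma']
  rfl

theorem biasedWeight_ne_top (x : Σ m, Fin m → FinTree) : biasedWeight ξ x ≠ ∞ := by
  refine ENNReal.mul_ne_top (ENNReal.mul_ne_top (ENNReal.natCast_ne_top _) (ξ.apply_ne_top _)) ?_
  exact ENNReal.prod_ne_top fun i _ => ENNReal.prod_ne_top fun u _ => ξ.apply_ne_top _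

/-- The law of the ball of radius `R` in a Galton-Watson tree with `n` vertices of out-degree in `A`
is asymptotically bounded below by that of Kesten's tree. -/
theorem eventually_mul_treeMass_le_treeSum (hmean : ∑' k : ℕ, (k : ℝ≥0∞) * ξ k = 1)
    (hξ : ξ 1 < 1) {A : Set ℕ} (hA : 0 ∈ A) (R : ℕ) {φ : UTree → ℝ≥0∞}
    (hφ : UTree.DependsOnBall R φ) : ∀ c < ∫⁻ τ, φ τ ∂kesten ξ,
      ∀ᶠ n in atTop, c * treeMass ξ A n ≤ treeSum ξ A φ n := by
  have := isProbabilityMeasure_kesten hmean hξ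
  induction R generalizing φ with
  | zero =>
    intro c hc
    have h1 : ∀ τ, φ τ = φ (UTree.mk PlaneTree.infiniteBranch) := fun τ => hφ _ _ (UTree.trunc_zero _ _)
    simp_rw [h1] at hc
    rw [lintegral_const, measure_univ, mul_one] at hc
    refine Eventually.of_forall fun n => ?_
    rw [treeSum, treeMass, ← ENNReal.tsum_mul_left]
    refine ENNReal.tsum_le_tsum fun t => ?_
    rw [h1, mul_left_comm, mul_comm c]
    exact mul_le_mul_right (mul_le_mul_right hc.le _) _
  | succ R ih =>
    intro c hc
    rw [lintegral_kesten_eq_tsum hmean hξ hφ.continuous.measurable, ENNReal.tsum_eq_iSup_sum,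
      lt_iSup_iff] at hc
    obtain ⟨S, hS⟩ := hc
    have hterm : ∀ x, ∀ b < biasedWeight ξ x * ∫⁻ τ, φ (addSiblings x τ) ∂kesten ξ,
        ∀ᶠ n in atTop, b * treeMass ξ A n ≤ biasedWeight ξ x *
          treeSum ξ A (fun τ => φ (addSiblings x τ)) (n - shift A x) := by
      intro x b hb
      have ha0 : biasedWeight ξ x ≠ 0 := by
        intro h0
        rw [h0, zero_mul] at hb
        exact not_lt_zero hb
      have hat := biasedWeight_ne_top (ξ := ξ) x
      have hb' : b / biasedWeight ξ x < ∫⁻ τ, φ (addSiblings x τ) ∂kesten ξ := by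
        rw [ENNReal.div_lt_iff (Or.inl ha0) (Or.inl hat), mul_comm]
        exact hb
      -- The available slack is shared: `c'` goes to the induction hypothesis, the ratio `b / (c' *
      -- biasedWeight ξ x) < 1` to the ratio limit theorem.
      obtain ⟨c', hc1, hc2⟩ := exists_between hb'
      have hbc : b < c' * biasedWeight ξ x :=
        (ENNReal.div_lt_iff (Or.inl ha0) (Or.inl hat)).1 hc1
      have hc0 : c' * biasedWeight ξ x ≠ 0 := hbc.ne_bot
      have hct : c' * biasedWeight ξ x ≠ ∞ := ENNReal.mul_ne_top hc2.ne_top hat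
      have hr : b / (c' * biasedWeight ξ x) < 1 := by
        rw [ENNReal.div_lt_iff (Or.inl hc0) (Or.inl hct), one_mul]
        exact hbc
      have h1 := eventually_mul_treeMass_le hmean hξ hA
        (treeMass_shift_ne_zero (offspring_zero_ne_zero hmean hξ) hA ha0) hr
      have h2 := ih (dependsOnBall_addSiblings hφ x) c' hc2
      have h3 := (tendsto_sub_atTop_nat (shift A x)).eventually (h1.and h2)
      filter_upwards [h3, eventually_ge_atTop (shift A x)] with n hn hge
      rw [Nat.sub_add_cancel hge] at hn
      calc b * treeMass ξ A n
          = c' * biasedWeight ξ x * (b / (c' * biasedWeight ξ x) * treeMass ξ A n) := by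
            rw [← mul_assoc, ENNReal.mul_div_cancel hc0 hct]
        _ ≤ c' * biasedWeight ξ x * treeMass ξ A (n - shift A x) := mul_le_mul_right hn.1 _
        _ = biasedWeight ξ x * (c' * treeMass ξ A (n - shift A x)) := by ring
        _ ≤ _ := mul_le_mul_right hn.2 _
    filter_upwards [eventually_mul_le_sum hterm S c hS, sum_le_treeSum (ξ := ξ) A φ S] with n h1 h2
    exact h1.trans h2

theorem gw_withCount (A : Set ℕ) (n : ℕ) : gw ξ (UTree.withCount A n) = treeMass ξ A n := by
  classical
  rw [gw_apply (UTree.measurableSet_withCount A n), treeMass]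
  refine tsum_congr fun t => ?_
  simp only [Set.indicator_apply, UTree.mk_mem_withCount, Pi.one_apply]

theorem gw_withCount_inter (A : Set ℕ) (n : ℕ) {B : Set UTree} (hB : MeasurableSet B) :
    gw ξ (UTree.withCount A n ∩ B) = treeSum ξ A (B.indicator 1) n := by
  classical
  rw [gw_apply ((UTree.measurableSet_withCount A n).inter hB), treeSum]
  refine tsum_congr fun t => ?_
  rw [Set.inter_indicator_one, Pi.mul_apply]
  simp only [Set.indicator_apply, UTree.mk_mem_withCount, Pi.one_apply]

/-- There are arbitrarily large trees of positive weight. -/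
theorem exists_treeMass_ne_zero (hmean : ∑' k : ℕ, (k : ℝ≥0∞) * ξ k = 1) (hξ : ξ 1 < 1)
    {A : Set ℕ} (hA : 0 ∈ A) (N : ℕ) : ∃ n, N ≤ n ∧ treeMass ξ A n ≠ 0 := by
  suffices h : ∃ t, N ≤ count A t ∧ weight ξ t ≠ 0 by
    obtain ⟨t, h1, h2⟩ := h
    refine ⟨_, h1, fun h0 => h2 ?_⟩
    simpa using ENNReal.tsum_eq_zero.1 h0 t
  have h0 := offspring_zero_ne_zero hmean hξ
  obtain ⟨k, hk, hk0⟩ := exists_two_le hmean hξ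
  obtain ⟨k, rfl⟩ : ∃ j, k = j + 1 := ⟨k - 1, by omega⟩
  induction N with
  | zero => exact ⟨concat (Fin.elim0 : Fin 0 → FinTree), Nat.zero_le _, by simpa [weight_concat]⟩
  | succ N ih =>
    obtain ⟨t, ht, hw⟩ := ih
    set leaf : FinTree := concat (Fin.elim0 : Fin 0 → FinTree) with hleaf
    have hl : weight ξ leaf = ξ 0 := by rw [hleaf, weight_concat]; simp
    refine ⟨concat (Fin.cons t fun _ => leaf : Fin (k + 1) → FinTree), ?_, ?_⟩
    · rw [count_concat, Fin.sum_univ_succ, Fin.cons_zero]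
      simp only [Fin.cons_succ, Finset.sum_const, Finset.card_univ, Fintype.card_fin, smul_eq_mul]
      have h1 := count_pos hA leaf
      have h2 : 1 ≤ k * count A leaf := Nat.one_le_iff_ne_zero.2 (Nat.mul_ne_zero (by omega) (by omega))
      omega
    · rw [weight_concat, Fin.prod_univ_succ, Fin.cons_zero]
      simp only [Fin.cons_succ, Finset.prod_const, hl]
      exact mul_ne_zero hk0 (mul_ne_zero hw (pow_ne_zero _ h0))

end FinTree

/-! ### Weak convergence -/

section Convergence

variable {ξ : PMF ℕ}

open FinTree

theorem isProbabilityMeasure_cond_withCount {A : Set ℕ} {n : ℕ}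
    (hn : 0 < gw ξ (UTree.withCount A n)) :
    IsProbabilityMeasure (ProbabilityTheory.cond (gw ξ) (UTree.withCount A n)) :=
  ProbabilityTheory.cond_isProbabilityMeasure_of_finite hn.ne'
    (by rw [gw_withCount]; exact treeMass_ne_top A n)

/-- An open set is the increasing union, over `R`, of the sets of trees whose ball of radius `R`
already forces membership; continuity from below does the rest. -/
theorem exists_lt_measure_dependsOnBall (μ : Measure UTree) {O : Set UTree} (hO : IsOpen O)
    {c : ℝ≥0∞} (hc : c < μ O) : ∃ (R : ℕ) (B : Set UTree), B ⊆ O ∧ MeasurableSet B ∧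
      UTree.DependsOnBall R (B.indicator (1 : UTree → ℝ≥0∞)) ∧ c < μ B := by
  classical
  set B : ℕ → Set UTree := fun R => {τ | ∀ σ : UTree, σ.trunc R = τ.trunc R → σ ∈ O} with hB
  have hdep : ∀ R, UTree.DependsOnBall R ((B R).indicator (1 : UTree → ℝ≥0∞)) := by
    intro R τ σ h
    have : τ ∈ B R ↔ σ ∈ B R := by
      change (∀ _, _ → _) ↔ (∀ _, _ → _)
      rw [h]
    simp only [Set.indicator_apply, this, Pi.one_apply]
  have hmeas : ∀ R, MeasurableSet (B R) := by
    intro R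
    have h1 : B R = (B R).indicator (1 : UTree → ℝ≥0∞) ⁻¹' {1} := by
      ext τ
      by_cases h : τ ∈ B R <;> simp [h]
    rw [h1]
    exact (hdep R).continuous.measurable (measurableSet_singleton 1)
  have hmono : Monotone B := fun R S hRS τ hτ σ hσ => hτ σ (UTree.trunc_eq_of_le hσ hRS)
  have hunion : ⋃ R, B R = O := by
    refine Set.Subset.antisymm (Set.iUnion_subset fun R τ hτ => hτ τ rfl) fun τ hτ => ?_
    obtain ⟨R, hR⟩ := UTree.exists_trunc_mem (hO.mem_nhds hτ)
    exact Set.mem_iUnion.2 ⟨R, hR⟩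
  rw [← hunion, hmono.measure_iUnion, lt_iSup_iff] at hc
  obtain ⟨R, hR⟩ := hc
  exact ⟨R, B R, fun τ hτ => hτ τ rfl, hmeas R, hdep R, hR⟩

/-- Local convergence to Kesten's tree of Galton-Watson trees conditioned on the number of vertices
with out-degree in `A`. -/
theorem tendsto_cond_withCount (hmean : ∑' k : ℕ, (k : ℝ≥0∞) * ξ k = 1) (hξ : ξ 1 < 1)
    {A : Set ℕ} (hA : 0 ∈ A) {V : ℕ → Set UTree} (hV : V = UTree.withCount A)
    {μ : {n : ℕ // 1 ≤ n ∧ 0 < gw ξ (V n)} → ProbabilityMeasure UTree}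
    (hμ : ∀ n, (μ n : Measure UTree) = ProbabilityTheory.cond (gw ξ) (V n))
    {κ : ProbabilityMeasure UTree} (hκ : (κ : Measure UTree) = kesten ξ) :
    Tendsto μ atTop (𝓝 κ) := by
  subst hV
  -- The admissible counts are unbounded, so `atTop` on the subtype means that the count tends to
  -- infinity.
  have hval : Tendsto (Subtype.val : {n : ℕ // 1 ≤ n ∧ 0 < gw ξ (UTree.withCount A n)} → ℕ)
      atTop atTop := by
    refine tendsto_atTop.2 fun b => ?_
    obtain ⟨n, hn, hn0⟩ := exists_treeMass_ne_zero hmean hξ hA (max b 1)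
    rw [← gw_withCount] at hn0
    filter_upwards [eventually_ge_atTop (⟨n, (le_max_right _ _).trans hn,
      pos_iff_ne_zero.2 hn0⟩ : {n : ℕ // 1 ≤ n ∧ 0 < gw ξ (UTree.withCount A n)})] with m hm
    exact ((le_max_left _ _).trans hn).trans hm
  -- Portmanteau: between probability measures, lower bounds on open sets imply weak convergence.
  refine tendsto_of_forall_isOpen_le_liminf' fun O hO => ?_
  rw [hκ]
  refine le_of_forall_lt fun c hc => ?_
  obtain ⟨c', hcc', hc'⟩ := exists_between hc
  refine hcc'.trans_le ?_
  obtain ⟨R, B, hBO, hBm, hBd, hB⟩ := exists_lt_measure_dependsOnBall (kesten ξ) hO hc'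
  rw [← lintegral_indicator_one hBm] at hB
  have hev := hval.eventually (eventually_mul_treeMass_le_treeSum hmean hξ hA R hBd c' hB)
  refine le_liminf_of_le (by isBoundedDefault) ?_
  filter_upwards [hev] with n hn
  rw [hμ, ProbabilityTheory.cond_apply (UTree.measurableSet_withCount A n), mul_comm,
    ← div_eq_mul_inv, ENNReal.le_div_iff_mul_le (Or.inl n.2.2.ne')
      (Or.inl (by rw [gw_withCount]; exact treeMass_ne_top A n)), gw_withCount]
  refine hn.trans ?_
  rw [← gw_withCount_inter A n hBm]
  exact measure_mono (Set.inter_subset_inter_right _ hBO)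

end Convergence

end

theorem mainTheorem7 (ξ : PMF ℕ) (hmean : ∑' k : ℕ, (k : ℝ≥0∞) * ξ k = 1) (hξ : ξ 1 < 1) :
    ∃ (hV : ∀ n : {n : ℕ // 1 ≤ n ∧ 0 < gw ξ (UTree.withVertices n)},
          IsProbabilityMeasure (gwVertices ξ n))
      (hL : ∀ n : {n : ℕ // 1 ≤ n ∧ 0 < gw ξ (UTree.withLeaves n)},
          IsProbabilityMeasure (gwLeaves ξ n))
      (hK : IsProbabilityMeasure (kesten ξ)),
      Tendsto (β := ProbabilityMeasure UTree) (fun n : {n : ℕ // 1 ≤ n ∧ 0 < gw ξ (UTree.withVertices n)} =>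
          ⟨gwVertices ξ n, hV n⟩) atTop (𝓝 ⟨kesten ξ, hK⟩) ∧
      Tendsto (β := ProbabilityMeasure UTree) (fun n : {n : ℕ // 1 ≤ n ∧ 0 < gw ξ (UTree.withLeaves n)} =>
          ⟨gwLeaves ξ n, hL n⟩) atTop (𝓝 ⟨kesten ξ, hK⟩) := by
  have hV : ∀ n : {n : ℕ // 1 ≤ n ∧ 0 < gw ξ (UTree.withVertices n)},
      IsProbabilityMeasure (gwVertices ξ n) := fun n => by
    have h := n.2.2
    rw [gwVertices]
    rw [UTree.withVertices_eq] at h ⊢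
    exact isProbabilityMeasure_cond_withCount h
  have hL : ∀ n : {n : ℕ // 1 ≤ n ∧ 0 < gw ξ (UTree.withLeaves n)},
      IsProbabilityMeasure (gwLeaves ξ n) := fun n => by
    have h := n.2.2
    rw [gwLeaves]
    rw [UTree.withLeaves_eq] at h ⊢
    exact isProbabilityMeasure_cond_withCount h
  refine ⟨hV, hL, isProbabilityMeasure_kesten hmean hξ, ?_, ?_⟩
  · exact tendsto_cond_withCount hmean hξ (Set.mem_univ 0) (funext UTree.withVertices_eq)
      (fun _ => rfl) rfl
  · exact tendsto_cond_withCount hmean hξ (Set.mem_singleton 0) (funext UTree.withLeaves_eq)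
      (fun _ => rfl) rfl
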